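/- All objects are of class $C^\infty$. Let $M$ be an $n$-dimensional manifold, $\mathcal E\to M$ a real vector bundle of rank $n$, $\phi:TM\to\mathcal E$ a smooth bundle map over $\mathrm{id}_M$ (fibrewise linear; its rank may vary from point to point), and $\nabla^{\mathcal E}$ a connection on $\mathcal E$. A connection $\nabla$ on $\mathcal E$ (or on the restriction of $\mathcal E$ to an open set) is called relatively torsion-free with respect to $\phi$ if $$\nabla_X\phi(Y)-\nabla_Y\phi(X)-\phi([X,Y])=0$$ for all vector fields $X,Y$; the triple $(\mathcal E,\phi,\nabla^{\mathcal E})$ is a coherent tangent bundle if $\nabla^{\mathcal E}$ is relatively torsion-free. Write $R^{\nabla}(X,Y)\eta=\nabla_X\nabla_Y\eta-\nabla_Y\nabla_X\eta-\nabla_{[X,Y]}\eta$ for the curvature of $\nabla$; $\nabla$ is flat if $R^{\nabla}=0$. Two relatively torsion-free connections $\nabla,\widehat\nabla$ on $\mathcal E|_U$, $U\subset M$ open, are projectively equivalent with respect to $\phi$ if there is $\rho\in\Gamma(\mathcal E^*|_U)$ with $$\widehat\nabla_X\eta=\nabla_X\eta+\rho(\phi(X))\,\eta+\rho(\eta)\,\phi(X)$$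 for all $X\in\Gamma(TU)$ and $\eta\in\Gamma(\mathcal E|_U)$. The connection $\nabla^{\mathcal E}$ is projectively flat with respect to $\phi$ if every point of $M$ has an open neighbourhood $U$ on which $\nabla^{\mathcal E}|_U$ is projectively equivalent, with respect to $\phi$, to some flat connection. **Theorem.** Let $(\mathcal E,\phi,\nabla^{\mathcal E})$ be a coherent tangent bundle over $M$. Assume that $\operatorname{rank}\phi\ge 2$ almost everywhere (that is, outside a subset of $M$ that has Lebesgue measure zero in charts) and that $\operatorname{tr}\{\eta\mapsto R^{\nabla^{\mathcal E}}(X,Y)\eta\}=0$ for all $X,Y\in\Gamma(TM)$. Then the following two conditions are equivalent: (i) the connection $\nabla^{\mathcal E}$ is projectively flat with respect to $\phi$; (ii) there exists a tensor field $A\in\Gamma(T^*M\otimes\mathcal E^*)$ such that $$R^{\nabla^{\mathcal E}}(X,Y)\eta=\frac1{n-1}\{A(Y,\eta)\phi(X)-A(X,\eta)\phi(Y)\}$$ and $$XA(Y,\eta)-YA(X,\eta)-A([X,Y],\eta)=A(Y,\nabla^{\mathcal E}_X\eta)-A(X,\nabla^{\mathcal E}_Y\eta)$$ hold for all $X,Y\in\Gamma(TM)$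 and $\eta\in\Gamma(\mathcal E)$. -/

import Mathlib

open Bundle Set MeasureTheory
open scoped Manifold ContDiff

noncomputable section

section SmoothSections

variable (n : ℕ) {M : Type*} [TopologicalSpace M] [ChartedSpace (EuclideanSpace ℝ (Fin n)) M]
  (F : Type*) [NormedAddCommGroup F] [NormedSpace ℝ F]
  {V : M → Type*} [TopologicalSpace (TotalSpace F V)] [∀ x, TopologicalSpace (V x)]
  [FiberBundle F V]

/-- `σ` restricts to a smooth section, over the set `U`, of the bundle `V` with model fibre `F`. -/
def SmoothSectionOn (σ : Π x : M, V x) (U : Set M) : Prop :=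
  ContMDiffOn (𝓡 n) ((𝓡 n).prod 𝓘(ℝ, F)) ∞ (fun x ↦ TotalSpace.mk' F x (σ x)) U

/-- `σ` is a (global) smooth section of the bundle `V` with model fibre `F`: `σ ∈ Γ(V)`. -/
def SmoothSection (σ : Π x : M, V x) : Prop :=
  ContMDiff (𝓡 n) ((𝓡 n).prod 𝓘(ℝ, F)) ∞ (fun x ↦ TotalSpace.mk' F x (σ x))

end SmoothSections

/-- `X` restricts to a smooth vector field on the set `U`. -/
def SmoothVectorFieldOn {n : ℕ} {M : Type*} [TopologicalSpace M]
    [ChartedSpace (EuclideanSpace ℝ (Fin n)) M] [IsManifold (𝓡 n) ∞ M]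
    (X : Π x : M, TangentSpace (𝓡 n) x) (U : Set M) : Prop :=
  SmoothSectionOn n (EuclideanSpace ℝ (Fin n)) X U

/-- `X` is a (global) smooth vector field: `X ∈ Γ(TM)`. -/
def SmoothVectorField {n : ℕ} {M : Type*} [TopologicalSpace M]
    [ChartedSpace (EuclideanSpace ℝ (Fin n)) M] [IsManifold (𝓡 n) ∞ M]
    (X : Π x : M, TangentSpace (𝓡 n) x) : Prop :=
  SmoothSection n (EuclideanSpace ℝ (Fin n)) X

/-- A subset of a smooth `n`-manifold has measure zero if its image in every chart of the atlas is
a Lebesgue null set. -/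
def ManifoldNull {n : ℕ} {M : Type*} [TopologicalSpace M]
    [ChartedSpace (EuclideanSpace ℝ (Fin n)) M] (S : Set M) : Prop :=
  ∀ e ∈ atlas (EuclideanSpace ℝ (Fin n)) M, volume (e '' (e.source ∩ S)) = 0

section Connections

/-! Argument order: for a connection `D`, the vector `D σ x v` is `(∇_v σ)(x)`. A connection on the
restriction of `V` to an open set `U` is represented by an operator `D` on sections over `M` which
satisfies the axioms of a smooth connection at the points of `U`; only the values of `D σ` at points
of `U` matter, and there they depend only on the restriction of `σ` to `U`. -/

variable {n : ℕ} {M : Type*} [TopologicalSpace M] [ChartedSpace (EuclideanSpace ℝ (Fin n)) M]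
  [IsManifold (𝓡 n) ∞ M]
  (F : Type*) [NormedAddCommGroup F] [NormedSpace ℝ F]
  {V : M → Type*} [TopologicalSpace (TotalSpace F V)]
  [∀ x, AddCommGroup (V x)] [∀ x, Module ℝ (V x)] [∀ x, TopologicalSpace (V x)]
  [∀ x, IsTopologicalAddGroup (V x)] [∀ x, ContinuousSMul ℝ (V x)]
  [FiberBundle F V] [VectorBundle ℝ F V]

/-- `D` is a smooth connection on the restriction of `V` to the open set `U`. -/
structure IsSmoothConnectionOn
    (D : (Π x : M, V x) → Π x : M, TangentSpace (𝓡 n) x →L[ℝ] V x) (U : Set M) : Prop where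
  isCovariantDerivativeOn : IsCovariantDerivativeOn F D U
  smooth : ContMDiffCovariantDerivativeOn F ∞ D U

/-- The curvature `R(X, Y)σ = ∇_X ∇_Y σ - ∇_Y ∇_X σ - ∇_[X,Y] σ`, as a section of `V`. -/
def curvature (D : (Π x : M, V x) → Π x : M, TangentSpace (𝓡 n) x →L[ℝ] V x)
    (X Y : Π x : M, TangentSpace (𝓡 n) x) (σ : Π x : M, V x) (x : M) : V x :=
  D (fun y ↦ D σ y (Y y)) x (X x) - D (fun y ↦ D σ y (X y)) x (Y x)
    - D σ x (VectorField.mlieBracket (𝓡 n) X Y x)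

/-- The connection `D` is flat over `U`: its curvature tensor vanishes there. -/
def FlatOn (D : (Π x : M, V x) → Π x : M, TangentSpace (𝓡 n) x →L[ℝ] V x) (U : Set M) : Prop :=
  ∀ X Y : Π x : M, TangentSpace (𝓡 n) x, SmoothVectorFieldOn X U → SmoothVectorFieldOn Y U →
    ∀ σ : Π x : M, V x, SmoothSectionOn n F σ U → ∀ x ∈ U, curvature D X Y σ x = 0

/-- The linear map `L` is the endomorphism `η ↦ R(X, Y)η` of the fibre `V x`. -/
def IsCurvatureEndomorphismAt (D : (Π x : M, V x) → Π x : M, TangentSpace (𝓡 n) x →L[ℝ] V x)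
    (X Y : Π x : M, TangentSpace (𝓡 n) x) (x : M) (L : V x →ₗ[ℝ] V x) : Prop :=
  ∀ σ : Π x : M, V x, SmoothSection n F σ → L (σ x) = curvature D X Y σ x

/-- `tr (η ↦ R(X, Y)η) = 0` for all vector fields `X`, `Y`. Since the curvature is tensorial, for all
`X`, `Y` and `x` there is exactly one `L` as below. -/
def TraceFreeCurvature (D : (Π x : M, V x) → Π x : M, TangentSpace (𝓡 n) x →L[ℝ] V x) : Prop :=
  ∀ X Y : Π x : M, TangentSpace (𝓡 n) x, SmoothVectorField X → SmoothVectorField Y →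
    ∀ (x : M) (L : V x →ₗ[ℝ] V x), IsCurvatureEndomorphismAt F D X Y x L →
      LinearMap.trace ℝ (V x) L = 0

/-- `D` is relatively torsion-free over `U` with respect to the bundle map `φ : TM → V`:
`∇_X φ(Y) - ∇_Y φ(X) - φ([X, Y]) = 0`. -/
def RelativelyTorsionFreeOn (φ : Π x : M, TangentSpace (𝓡 n) x →L[ℝ] V x)
    (D : (Π x : M, V x) → Π x : M, TangentSpace (𝓡 n) x →L[ℝ] V x) (U : Set M) : Prop :=
  ∀ X Y : Π x : M, TangentSpace (𝓡 n) x, SmoothVectorFieldOn X U → SmoothVectorFieldOn Y U →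
    ∀ x ∈ U, D (fun y ↦ φ y (Y y)) x (X x) - D (fun y ↦ φ y (X y)) x (Y x)
      - φ x (VectorField.mlieBracket (𝓡 n) X Y x) = 0

/-- Over `U`, the connections `D` and `D'` are projectively equivalent with respect to `φ`: both are
relatively torsion-free and there is a smooth section `ρ` of the dual bundle of `V` over `U` with
`∇'_X σ = ∇_X σ + ρ(φ(X)) σ + ρ(σ) φ(X)`. -/
def ProjectivelyEquivalentOn (φ : Π x : M, TangentSpace (𝓡 n) x →L[ℝ] V x)
    (D D' : (Π x : M, V x) → Π x : M, TangentSpace (𝓡 n) x →L[ℝ] V x) (U : Set M) : Prop :=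
  RelativelyTorsionFreeOn φ D U ∧ RelativelyTorsionFreeOn φ D' U ∧
    ∃ ρ : Π x : M, V x →L[ℝ] ℝ, SmoothSectionOn n (F →L[ℝ] ℝ) ρ U ∧
      ∀ X : Π x : M, TangentSpace (𝓡 n) x, SmoothVectorFieldOn X U →
        ∀ σ : Π x : M, V x, SmoothSectionOn n F σ U → ∀ x ∈ U,
          D' σ x (X x) = D σ x (X x) + ρ x (φ x (X x)) • σ x + ρ x (σ x) • φ x (X x)

/-- `D` is projectively flat with respect to `φ`: around every point it is projectively equivalent
to some flat connection. -/
def ProjectivelyFlat (φ : Π x : M, TangentSpace (𝓡 n) x →L[ℝ] V x)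
    (D : (Π x : M, V x) → Π x : M, TangentSpace (𝓡 n) x →L[ℝ] V x) : Prop :=
  ∀ p : M, ∃ U : Set M, IsOpen U ∧ p ∈ U ∧
    ∃ D' : (Π x : M, V x) → Π x : M, TangentSpace (𝓡 n) x →L[ℝ] V x,
      IsSmoothConnectionOn F D' U ∧ FlatOn F D' U ∧ ProjectivelyEquivalentOn F φ D D' U

/-- `R(X, Y)η = (1 / (n - 1)) (A(Y, η) φ(X) - A(X, η) φ(Y))` for all `X`, `Y` and `η`. -/
def CurvatureCondition (φ : Π x : M, TangentSpace (𝓡 n) x →L[ℝ] V x)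
    (D : (Π x : M, V x) → Π x : M, TangentSpace (𝓡 n) x →L[ℝ] V x)
    (A : Π x : M, TangentSpace (𝓡 n) x →L[ℝ] V x →L[ℝ] ℝ) : Prop :=
  ∀ X Y : Π x : M, TangentSpace (𝓡 n) x, SmoothVectorField X → SmoothVectorField Y →
    ∀ η : Π x : M, V x, SmoothSection n F η → ∀ x : M,
      curvature D X Y η x =
        (1 / ((n : ℝ) - 1)) • (A x (Y x) (η x) • φ x (X x) - A x (X x) (η x) • φ x (Y x))

/-- `X(A(Y, η)) - Y(A(X, η)) - A([X, Y], η) = A(Y, ∇_X η) - A(X, ∇_Y η)` for all `X`, `Y` and `η`. -/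
def CodazziCondition (D : (Π x : M, V x) → Π x : M, TangentSpace (𝓡 n) x →L[ℝ] V x)
    (A : Π x : M, TangentSpace (𝓡 n) x →L[ℝ] V x →L[ℝ] ℝ) : Prop :=
  ∀ X Y : Π x : M, TangentSpace (𝓡 n) x, SmoothVectorField X → SmoothVectorField Y →
    ∀ η : Π x : M, V x, SmoothSection n F η → ∀ x : M,
      mvfderiv (𝓡 n) (fun y ↦ A y (Y y) (η y)) x (X x)
        - mvfderiv (𝓡 n) (fun y ↦ A y (X y) (η y)) x (Y x)
        - A x (VectorField.mlieBracket (𝓡 n) X Y x) (η x)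
      = A x (Y x) (D η x (X x)) - A x (X x) (D η x (Y x))

end Connections

/-- A coherent tangent bundle over the smooth `n`-manifold `M`, on the vector bundle `V` with model
fibre `F`: the bundle has rank `n`, `phi : TM → V` is a smooth bundle map (of possibly varying
rank), and `conn` is a smooth connection on `V` that is relatively torsion-free with respect to
`phi`. -/
structure CoherentTangentBundle (n : ℕ) (M : Type*) [TopologicalSpace M]
    [ChartedSpace (EuclideanSpace ℝ (Fin n)) M] [IsManifold (𝓡 n) ∞ M]
    (F : Type*) [NormedAddCommGroup F] [NormedSpace ℝ F]
    (V : M → Type*) [TopologicalSpace (TotalSpace F V)]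
    [∀ x, AddCommGroup (V x)] [∀ x, Module ℝ (V x)] [∀ x, TopologicalSpace (V x)]
    [∀ x, IsTopologicalAddGroup (V x)] [∀ x, ContinuousSMul ℝ (V x)]
    [FiberBundle F V] [VectorBundle ℝ F V] [ContMDiffVectorBundle ∞ F V (𝓡 n)] where
  rank_eq : Module.finrank ℝ F = n
  phi : Π x : M, TangentSpace (𝓡 n) x →L[ℝ] V x
  smooth_phi : SmoothSection n (EuclideanSpace ℝ (Fin n) →L[ℝ] F) phi
  conn : (Π x : M, V x) → Π x : M, TangentSpace (𝓡 n) x →L[ℝ] V x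
  smooth_conn : IsSmoothConnectionOn F conn univ
  relativelyTorsionFree : RelativelyTorsionFreeOn phi conn univ

/-- The rank of `φ : TM → V` is at least `k` almost everywhere. -/
def RankGEAlmostEverywhere {n : ℕ} {M : Type*} [TopologicalSpace M]
    [ChartedSpace (EuclideanSpace ℝ (Fin n)) M]
    {V : M → Type*} [∀ x, AddCommGroup (V x)] [∀ x, Module ℝ (V x)] [∀ x, TopologicalSpace (V x)]
    (φ : Π x : M, TangentSpace (𝓡 n) x →L[ℝ] V x) (k : ℕ) : Prop :=
  ManifoldNull (n := n) {x : M | ¬ k ≤ Module.finrank ℝ (LinearMap.range (φ x).toLinearMap)}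

end

/-! For a section ρ of the dual bundle put P(X, η) = (∇_X ρ)(η) - ρ(φ(X)) ρ(η) (`projectiveTensor`).
Because ∇ is relatively torsion-free, the curvature of the connection changed by ρ is R(X, Y)η +
(P(X, φY) - P(Y, φX)) η + P(X, η) φ(Y) - P(Y, η) φ(X); this is `localCurvature_projectiveChange`,
and both directions rest on it.

If the changed connection is flat, this expresses R through P. Taking the trace over η gives (n +
1)(P(Y, φX) - P(X, φY)) = 0, since R is trace-free. So P(X, φY) is symmetric in X and Y, and R(X,
Y)η = P(Y, η) φ(X) - P(X, η) φ(Y) (`projectiveTensor_symm_of_flat`). The Codazzi equation for P is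
then the Ricci identity for ρ (`projectiveTensor_codazzi`), and A = (n - 1) P solves both conditions
locally. The curvature condition determines A wherever φ has rank at least two. Such points are
dense, so smooth local solutions agree by continuity and glue (`exists_global_tensor`).

Conversely, put B = A / (n - 1) and look for ρ with P = B. This prescribes the whole derivative of ρ
as a function of the point and of ρ, that is, a total system dρ = G(x, ρ) (`projectiveSystem`).
Trace-freeness of R makes B(X, φY) symmetric; with torsion-freeness and the two conditions on A,
this is what makes the system integrable (`projectiveSystem_integrable`). The Frobenius theorem
`exists_eventually_hasFDerivAt_of_total_system` gives a local solution, and the curvature formula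
shows that the connection changed by it is flat.

All computations take place in a chart and a trivialization around a fixed point, where ∇ is d + Γ.
The translation uses that germs of sections extend to global sections, so identities tested on
global sections become identities at a point. -/

noncomputable section

/-! ### Frobenius theorem for total differential systems -/

section TotalSystem

open Metric Filter Topology
open scoped NNReal

variable {E W : Type*} [NormedAddCommGroup E] [NormedSpace ℝ E] [NormedAddCommGroup W]
  [NormedSpace ℝ W]

/-- The first order Taylor remainder of a map with Lipschitz derivative is quadratic. -/
theorem Convex.norm_taylor_remainder_le_of_lipschitzOnWith {f : E → W} {f' : E → E →L[ℝ] W}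
    {s : Set E} (hs : Convex ℝ s) {C : ℝ≥0} (hf : ∀ x ∈ s, HasFDerivWithinAt f (f' x) s x)
    (hC : LipschitzOnWith C f' s) {x y : E} (hx : x ∈ s) (hy : y ∈ s) :
    ‖f y - f x - f' x (y - x)‖ ≤ C * ‖y - x‖ ^ 2 := by
  -- The mean value inequality is applied on this smaller convex set, where `f'` differs from `f' x`
  -- by at most `C * ‖y - x‖`.
  have hx' : x ∈ s ∩ closedBall x ‖y - x‖ := ⟨hx, mem_closedBall_self (norm_nonneg _)⟩
  have hy' : y ∈ s ∩ closedBall x ‖y - x‖ := ⟨hy, by simp [dist_eq_norm]⟩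
  have := (hs.inter (convex_closedBall x ‖y - x‖)).norm_image_sub_le_of_norm_hasFDerivWithin_le'
    (fun z hz ↦ (hf z hz.1).mono inter_subset_left) (φ := f' x) (C := C * ‖y - x‖) ?_ hx' hy'
  · exact this.trans_eq (by ring)
  · intro z hz
    refine (hC.norm_sub_le hz.1 hx).trans ?_
    gcongr
    simpa [dist_eq_norm] using hz.2

variable {G : E × W → E →L[ℝ] W} {G' : E × W → E × W →L[ℝ] E →L[ℝ] W} {z₀ : E} {u₀ : W}
  {r δ : ℝ} {M L C : ℝ≥0}

/-- Solutions along rays of the total system `du = G (x, u)`. -/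
theorem exists_hasDerivWithinAt_ray [CompleteSpace W] (hδ : 0 ≤ δ) (hr : 0 ≤ r) (hδr : δ ≤ r)
    (hM : ∀ q ∈ closedBall (z₀, u₀) r, ‖G q‖ ≤ M) (hL : LipschitzOnWith L G (closedBall (z₀, u₀) r))
    (hMδ : M * δ ≤ r) {y : E} (hy : ‖y‖ ≤ δ) :
    ∃ w : ℝ → W, w 0 = u₀ ∧ ∀ t ∈ Icc (0 : ℝ) 1, w t ∈ closedBall u₀ r ∧
      HasDerivWithinAt w (G (z₀ + t • y, w t) y) (Icc 0 1) t := by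
  lift δ to ℝ≥0 using hδ
  lift r to ℝ≥0 using hr
  have hmem : ∀ t ∈ Icc (0 : ℝ) 1, ∀ w ∈ closedBall u₀ (r : ℝ),
      (z₀ + t • y, w) ∈ closedBall (z₀, u₀) (r : ℝ) := by
    intro t ht w hw
    rw [← closedBall_prod_same]
    refine ⟨?_, hw⟩
    simp only [mem_closedBall, dist_self_add_left, norm_smul, Real.norm_eq_abs, abs_of_nonneg ht.1]
    nlinarith [norm_nonneg y, ht.2]
  -- Time runs over all of [0, 1]: a solution has speed at most `M * δ ≤ r`, so it cannot leave the
  -- ball of radius `r` before time 1.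
  have hP : IsPicardLindelof (fun t w ↦ G (z₀ + t • y, w) y) (tmin := 0) (tmax := 1)
      ⟨0, by simp⟩ u₀ r 0 (M * δ) (L * δ) := by
    refine ⟨fun t ht ↦ ?_, fun w hw ↦ ?_, fun t ht w hw ↦ ?_, ?_⟩
    · refine LipschitzOnWith.of_dist_le_mul fun w hw w' hw' ↦ ?_
      rw [dist_eq_norm, ← sub_apply]
      refine (ContinuousLinearMap.le_opNorm _ _).trans ?_
      have := hL.norm_sub_le (hmem t ht w hw) (hmem t ht w' hw')
      simp only [Prod.mk_sub_mk, sub_self, Prod.norm_mk, norm_zero, norm_nonneg, sup_of_le_right]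
        at this
      rw [dist_eq_norm]
      push_cast
      calc _ ≤ (L * ‖w - w'‖) * δ := by gcongr
        _ = _ := by ring
    · have : ContinuousOn (fun t : ℝ ↦ G (z₀ + t • y, w)) (Icc 0 1) :=
        hL.continuousOn.comp (by fun_prop) fun t ht ↦ hmem t ht w hw
      exact this.clm_apply continuousOn_const
    · push_cast
      exact (ContinuousLinearMap.le_opNorm _ _).trans (by gcongr; exact hM _ (hmem t ht w hw))
    · simpa using hMδ
  -- The fixed point of the Picard map is kept, not only the solution it yields: its values are
  -- known to stay in the ball, which the estimates below need.
  obtain ⟨α, hα⟩ := ODE.FunSpace.exists_isFixedPt_next hP (mem_closedBall_self (by simp))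
  refine ⟨α.compProj, ?_, fun t ht ↦ ⟨?_, ?_⟩⟩
  · have := ODE.FunSpace.compProj_val (α := α) (t := ⟨0, by simp⟩)
    rw [← hα, ODE.FunSpace.next_apply₀] at this
    rw [← hα]
    exact this
  · exact α.compProj_mem_closedBall hP.mul_max_le
  · apply ODE.hasDerivWithinAt_picard_Icc (left_mem_Icc.2 zero_le_one) hP.continuousOn_uncurry
      α.continuous_compProj.continuousOn (fun _ ht' ↦ α.compProj_mem_closedBall hP.mul_max_le)
      u₀ ht |>.congr_of_mem _ ht
    intro t' ht'
    nth_rw 1 [← hα]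
    rw [ODE.FunSpace.compProj_of_mem ht', ODE.FunSpace.next_apply]

/-- With zero initial value the Gronwall bound is linear in `ε`. A forcing term of size `‖h‖` or
`‖h‖ ^ 2` therefore gives an error of the same order, with a constant independent of `h`. -/
theorem norm_le_gronwallBound_mul_of_hasDerivWithinAt {f f' : ℝ → W} {K ε : ℝ} (hK : 0 ≤ K)
    (hε : 0 ≤ ε) (hf : ∀ t ∈ Icc (0 : ℝ) 1, HasDerivWithinAt f (f' t) (Icc 0 1) t) (h0 : f 0 = 0)
    (bound : ∀ t ∈ Icc (0 : ℝ) 1, ‖f' t‖ ≤ K * ‖f t‖ + ε) :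
    ∀ t ∈ Icc (0 : ℝ) 1, ‖f t‖ ≤ gronwallBound 0 K 1 1 * ε := by
  intro t ht
  have := norm_le_gronwallBound_of_norm_deriv_right_le (δ := 0) (K := K) (ε := ε)
    (fun t ht ↦ (hf t ht).continuousWithinAt)
    (fun t ht ↦ (hf t (Ico_subset_Icc_self ht)).mono_of_mem_nhdsWithin
      (Icc_mem_nhdsGE_of_mem ht)) (by simp [h0])
    (fun t ht ↦ bound t (Ico_subset_Icc_self ht)) t ht
  refine this.trans ((gronwallBound_mono le_rfl hε hK (by linarith [ht.2] : t - 0 ≤ 1)).trans_eq ?_)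
  by_cases h : K = 0
  · simp [h, gronwallBound_K0]
  · simp [gronwallBound_of_K_ne_0 h]
    ring

/-- If the total system `du = G (x, u)` is integrable, then its solutions along rays depend
differentiably on the direction, with the derivative prescribed by the system. -/
theorem exists_norm_ray_sub_le (hδ : 0 ≤ δ) (hδr : δ ≤ r)
    (hM : ∀ q ∈ closedBall (z₀, u₀) r, ‖G q‖ ≤ M) (hL : LipschitzOnWith L G (closedBall (z₀, u₀) r))
    (hG : ∀ q ∈ closedBall (z₀, u₀) r, HasFDerivWithinAt G (G' q) (closedBall (z₀, u₀) r) q)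
    (hL' : ∀ q ∈ closedBall (z₀, u₀) r, ‖G' q‖ ≤ L)
    (hC : LipschitzOnWith C G' (closedBall (z₀, u₀) r))
    (hint : ∀ q ∈ closedBall (z₀, u₀) r, ∀ h k, G' q (h, G q h) k = G' q (k, G q k) h) :
    ∃ c : ℝ, ∀ y h : E, ‖y‖ ≤ δ → ‖y + h‖ ≤ δ → ∀ w v : ℝ → W, w 0 = u₀ → v 0 = u₀ →
      (∀ t ∈ Icc (0 : ℝ) 1, w t ∈ closedBall u₀ r ∧
        HasDerivWithinAt w (G (z₀ + t • y, w t) y) (Icc 0 1) t) →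
      (∀ t ∈ Icc (0 : ℝ) 1, v t ∈ closedBall u₀ r ∧
        HasDerivWithinAt v (G (z₀ + t • (y + h), v t) (y + h)) (Icc 0 1) t) →
      ‖v 1 - w 1 - G (z₀ + y, w 1) h‖ ≤ c * ‖h‖ ^ 2 := by
  have hmem : ∀ y : E, ‖y‖ ≤ δ → ∀ t ∈ Icc (0 : ℝ) 1, ∀ w ∈ closedBall u₀ (r : ℝ),
      (z₀ + t • y, w) ∈ closedBall (z₀, u₀) (r : ℝ) := by
    intro y hy t ht w hw
    rw [← closedBall_prod_same]
    refine ⟨?_, hw⟩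
    simp only [mem_closedBall, dist_self_add_left, norm_smul, Real.norm_eq_abs, abs_of_nonneg ht.1]
    nlinarith [norm_nonneg y, ht.2]
  set g := gronwallBound 0 (L * δ) 1 1
  have hg : 0 ≤ g := by
    have := gronwallBound_mono le_rfl zero_le_one (by positivity : 0 ≤ L * δ) (zero_le_one (α := ℝ))
    rwa [gronwallBound_x0] at this
  -- Lipschitz constant, in the direction `h`, of the points (base point, value) on the two rays: 1
  -- for the base points, and `g * (L * δ + M)` from Gronwall for the values.
  set b := 1 + g * (L * δ + M)
  have hb : 0 ≤ b := by positivity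
  refine ⟨g * (C * b ^ 2 * δ + L * b), fun y h hy hyh w v hw0 hv0 hw hv ↦ ?_⟩
  have hdist : ∀ t ∈ Icc (0 : ℝ) 1,
      ‖((z₀ + t • (y + h), v t) : E × W) - (z₀ + t • y, w t)‖ ≤ ‖h‖ + ‖v t - w t‖ := by
    intro t ht
    rw [Prod.mk_sub_mk, add_sub_add_left_eq_sub, ← smul_sub, add_sub_cancel_left]
    refine (norm_prod_le_iff.2 ⟨?_, ?_⟩)
    · rw [norm_smul, Real.norm_eq_abs, abs_of_nonneg ht.1]
      nlinarith [norm_nonneg h, norm_nonneg (v t - w t), ht.2]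
    · simp
  have hGd : ∀ t ∈ Icc (0 : ℝ) 1, ‖G (z₀ + t • (y + h), v t) - G (z₀ + t • y, w t)‖ ≤
      L * (‖h‖ + ‖v t - w t‖) := fun t ht ↦
    (hL.norm_sub_le (hmem _ hyh t ht _ (hv t ht).1) (hmem _ hy t ht _ (hw t ht).1)).trans
      (by gcongr; exact hdist t ht)
  have hd : ∀ t ∈ Icc (0 : ℝ) 1, ‖v t - w t‖ ≤ g * ((L * δ + M) * ‖h‖) := by
    refine norm_le_gronwallBound_mul_of_hasDerivWithinAt (by positivity) (by positivity)
      (fun t ht ↦ (hv t ht).2.sub (hw t ht).2) (by simp [hw0, hv0]) fun t ht ↦ ?_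
    have e : G (z₀ + t • (y + h), v t) (y + h) - G (z₀ + t • y, w t) y =
        (G (z₀ + t • (y + h), v t) - G (z₀ + t • y, w t)) y + G (z₀ + t • (y + h), v t) h := by
      simp only [map_add, sub_apply]
      abel
    have n1 : ‖(G (z₀ + t • (y + h), v t) - G (z₀ + t • y, w t)) y‖ ≤
        L * (‖h‖ + ‖v t - w t‖) * δ :=
      (ContinuousLinearMap.le_opNorm _ _).trans (by gcongr; exact hGd t ht)
    have n2 : ‖G (z₀ + t • (y + h), v t) h‖ ≤ M * ‖h‖ :=
      (ContinuousLinearMap.le_opNorm _ _).trans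
        (by gcongr; exact hM _ (hmem _ hyh t ht _ (hv t ht).1))
    rw [e]
    refine (norm_add_le _ _).trans ((add_le_add n1 n2).trans_eq (by ring))
  have hd' : ∀ t ∈ Icc (0 : ℝ) 1,
      ‖((z₀ + t • (y + h), v t) : E × W) - (z₀ + t • y, w t)‖ ≤ b * ‖h‖ := fun t ht ↦
    (hdist t ht).trans ((add_le_add_right (hd t ht) _).trans_eq (by ring))
  -- At time `t` the base points differ by `t • h`, so a solution of the system should change by `t
  -- • G h` to first order. Gronwall is applied to the error of this prediction.
  have key := norm_le_gronwallBound_mul_of_hasDerivWithinAt (K := L * δ)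
    (ε := (C * b ^ 2 * δ + L * b) * ‖h‖ ^ 2)
    (f := fun t ↦ v t - w t - t • G (z₀ + t • y, w t) h)
    (f' := fun t ↦ G (z₀ + t • (y + h), v t) (y + h) - G (z₀ + t • y, w t) y -
      (t • G' (z₀ + t • y, w t) (y, G (z₀ + t • y, w t) y) h + (1 : ℝ) • G (z₀ + t • y, w t) h))
    (by positivity) (by positivity) ?_ (by simp [hw0, hv0]) ?_ 1 (right_mem_Icc.2 zero_le_one)
  · simpa [mul_assoc] using key
  · intro t ht
    refine ((hv t ht).2.sub (hw t ht).2).sub ((hasDerivWithinAt_id t _).smul ?_)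
    have h1 : HasDerivWithinAt (fun t : ℝ ↦ (z₀ + t • y, w t)) (y, G (z₀ + t • y, w t) y)
        (Icc 0 1) t := by
      refine HasDerivWithinAt.prodMk ?_ (hw t ht).2
      simpa using ((hasDerivWithinAt_id t (Icc 0 1)).smul_const y).const_add z₀
    have h2 := (hG _ (hmem y hy t ht _ (hw t ht).1)).comp_hasDerivWithinAt t h1
      fun s hs ↦ hmem y hy s hs _ (hw s hs).1
    simpa using h2.clm_apply (hasDerivWithinAt_const t (Icc 0 1) h)
  · intro t ht
    have hq := hmem y hy t ht _ (hw t ht).1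
    have hq' := hmem _ hyh t ht _ (hv t ht).1
    set q : E × W := (z₀ + t • y, w t) with hqd
    set q' : E × W := (z₀ + t • (y + h), v t) with hqd'
    have hΔ : q' - q = t • (h, G q h) + (0, v t - w t - t • G q h) := by
      simp [hqd, hqd']
    -- Integrability replaces `G' q (y, G q y) h` by `G' q (h, G q h) y`, which belongs to the
    -- linear part of `G q' - G q` applied to `y`. What remains is two terms of order `‖h‖ ^ 2` and
    -- one linear in the error itself.
    have e : G q' (y + h) - G q y - (t • G' q (y, G q y) h + (1 : ℝ) • G q h) =
        (G q' - G q - G' q (q' - q)) y + (G q' - G q) h + G' q (0, v t - w t - t • G q h) y := by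
      rw [hΔ, (G' q).map_add, (G' q).map_smul, ← hint q hq h y]
      simp only [map_add, sub_apply, add_apply, smul_apply, one_smul]
      abel
    rw [e]
    have n1 : ‖(G q' - G q - G' q (q' - q)) y‖ ≤ C * (b * ‖h‖) ^ 2 * δ := by
      refine (ContinuousLinearMap.le_opNorm _ _).trans ?_
      gcongr
      refine ((convex_closedBall _ _).norm_taylor_remainder_le_of_lipschitzOnWith hG hC hq hq').trans
        ?_
      gcongr
      exact hd' t ht
    have n2 : ‖(G q' - G q) h‖ ≤ L * (b * ‖h‖) * ‖h‖ := by
      refine (ContinuousLinearMap.le_opNorm _ _).trans ?_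
      gcongr
      exact (hL.norm_sub_le hq' hq).trans (by gcongr; exact hd' t ht)
    have n3 : ‖G' q (0, v t - w t - t • G q h) y‖ ≤ L * ‖v t - w t - t • G q h‖ * δ := by
      refine (ContinuousLinearMap.le_opNorm _ _).trans ?_
      gcongr
      refine (ContinuousLinearMap.le_opNorm _ _).trans ?_
      gcongr
      · exact hL' q hq
      · simp
    refine (norm_add₃_le).trans ((add_le_add_three n1 n2 n3).trans_eq (by ring))

/-- **Frobenius theorem** for total systems `du = G (x, u)`: a system that is integrable near
`(z₀, u₀)` has a solution near `z₀`. -/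
theorem exists_eventually_hasFDerivAt_of_total_system [CompleteSpace W]
    (hG : ContDiffAt ℝ 2 G (z₀, u₀))
    (hint : ∀ᶠ q in 𝓝 (z₀, u₀), ∀ h k, fderiv ℝ G q (h, G q h) k = fderiv ℝ G q (k, G q k) h) :
    ∃ u : E → W, ∀ᶠ x in 𝓝 z₀, HasFDerivAt u (G (x, u x)) x := by
  obtain ⟨L₁, s₁, hs₁, hL₁⟩ := (hG.of_le one_le_two).exists_lipschitzOnWith
  obtain ⟨C, s₂, hs₂, hC⟩ := (hG.fderiv_right (m := 1) le_rfl).exists_lipschitzOnWith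
  have hd : ∀ᶠ q in 𝓝 (z₀, u₀), DifferentiableAt ℝ G q :=
    (hG.eventually (by simp)).mono fun q hq ↦ hq.differentiableAt (by simp)
  have hM₁ : ∀ᶠ q in 𝓝 (z₀, u₀), ‖G q‖ < ‖G (z₀, u₀)‖ + 1 :=
    hG.continuousAt.norm.eventually (gt_mem_nhds (lt_add_one _))
  have hL₂ : ∀ᶠ q in 𝓝 (z₀, u₀), ‖fderiv ℝ G q‖ < ‖fderiv ℝ G (z₀, u₀)‖ + 1 :=
    (hG.fderiv_right (m := 1) le_rfl).continuousAt.norm.eventually (gt_mem_nhds (lt_add_one _))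
  obtain ⟨r, hr, hball⟩ := Metric.nhds_basis_closedBall.eventually_iff.1
    (hint.and (hd.and (hM₁.and (hL₂.and (eventually_mem_set.2 (inter_mem hs₁ hs₂))))))
  set M : ℝ≥0 := ‖G (z₀, u₀)‖₊ + 1
  -- One constant serves both as a Lipschitz constant of `G` and as a bound for its derivative.
  set L : ℝ≥0 := L₁ + (‖fderiv ℝ G (z₀, u₀)‖₊ + 1)
  have hM : ∀ q ∈ closedBall (z₀, u₀) r, ‖G q‖ ≤ M := fun q hq ↦ by
    simpa [M] using (hball hq).2.2.1.le
  have hL : LipschitzOnWith L G (closedBall (z₀, u₀) r) :=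
    (hL₁.mono fun q hq ↦ (hball hq).2.2.2.2.1).weaken (by simp [L])
  have hL' : ∀ q ∈ closedBall (z₀, u₀) r, ‖fderiv ℝ G q‖ ≤ L := fun q hq ↦
    (hball hq).2.2.2.1.le.trans (by simp [L])
  obtain ⟨δ, hδ, hδr, hMδ⟩ : ∃ δ : ℝ, 0 < δ ∧ δ ≤ r ∧ M * δ ≤ r := by
    refine ⟨min r (r / M), by positivity, min_le_left _ _, ?_⟩
    calc M * min r (r / M) ≤ M * (r / M) := by gcongr; exact min_le_right _ _
      _ = r := mul_div_cancel₀ _ (by simp only [M]; positivity)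
  have hray := fun y (hy : ‖y‖ ≤ δ) ↦ exists_hasDerivWithinAt_ray hδ.le hr.le hδr hM hL hMδ hy
  choose! w hw0 hw using hray
  obtain ⟨c, hc⟩ := exists_norm_ray_sub_le hδ.le hδr hM hL
    (fun q hq ↦ (hball hq).2.1.hasFDerivAt.hasFDerivWithinAt) hL'
    (hC.mono fun q hq ↦ (hball hq).2.2.2.2.2) (fun q hq ↦ (hball hq).1)
  -- The only possible solution with value `u₀` at `z₀`: its restriction to the ray towards `x` must
  -- solve the ray equation.
  refine ⟨fun x ↦ w (x - z₀) 1, ?_⟩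
  filter_upwards [ball_mem_nhds z₀ hδ] with x hx
  rw [mem_ball_iff_norm] at hx
  rw [hasFDerivAt_iff_isLittleO_nhds_zero]
  refine Asymptotics.IsBigO.trans_isLittleO (g := fun h : E ↦ ‖h‖ ^ 2) ?_
    (Asymptotics.isLittleO_norm_pow_id one_lt_two)
  refine Asymptotics.IsBigO.of_bound c ?_
  have : ∀ᶠ h in 𝓝 (0 : E), ‖x - z₀ + h‖ < δ := by
    have : Continuous fun h : E ↦ ‖x - z₀ + h‖ := by fun_prop
    exact this.continuousAt.eventually (gt_mem_nhds (by simpa using hx))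
  filter_upwards [this] with h hh
  have := hc (x - z₀) h hx.le hh.le _ _ (hw0 _ hx.le) (hw0 _ hh.le) (hw _ hx.le) (hw _ hh.le)
  simpa [add_sub_right_comm] using this

/-- Bootstrapping: a solution of a smooth total system is smooth. -/
theorem contDiffOn_of_total_system {s : Set E} {t : Set (E × W)} (hs : IsOpen s)
    (hG : ContDiffOn ℝ ∞ G t) {u : E → W} (hu : ∀ x ∈ s, HasFDerivAt u (G (x, u x)) x)
    (hut : ∀ x ∈ s, (x, u x) ∈ t) : ContDiffOn ℝ ∞ u s := by
  refine contDiffOn_infty.2 fun k ↦ ?_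
  induction k with
  | zero => exact contDiffOn_zero.2 fun x hx ↦ (hu x hx).continuousAt.continuousWithinAt
  | succ k ih =>
    push_cast
    refine (contDiffOn_succ_iff_fderiv_of_isOpen hs).2
      ⟨fun x hx ↦ (hu x hx).differentiableAt.differentiableWithinAt, by simp, ?_⟩
    -- The derivative of `u` is `G (x, u x)`, hence as smooth as `u` is already known to be; this
    -- gains one order.
    exact ((hG.of_le (by exact_mod_cast le_top)).comp (contDiffOn_id.prodMk ih) hut).congr
      fun x hx ↦ (hu x hx).fderiv

end TotalSystem

/-! ### Connections, curvature and projective changes on a trivial bundle -/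

section LocalConnections

open ContinuousLinearMap

set_option synthInstance.maxHeartbeats 200000
set_option maxHeartbeats 1000000

variable {E F : Type*} [NormedAddCommGroup E] [NormedSpace ℝ E] [NormedAddCommGroup F]
  [NormedSpace ℝ F]

/-- The curvature of the connection with Christoffel form `Γ` on a trivial bundle. -/
def localCurvature (Γ : E → E →L[ℝ] F →L[ℝ] F) (z h k : E) : F →L[ℝ] F :=
  fderiv ℝ Γ z h k - fderiv ℝ Γ z k h + (Γ z h).comp (Γ z k) - (Γ z k).comp (Γ z h)

/-- The Christoffel form of the connection `∇_X σ + ρ(φ(X)) σ + ρ(σ) φ(X)`. -/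
def projectiveChange (Γ : E → E →L[ℝ] F →L[ℝ] F) (φ : E → E →L[ℝ] F) (ρ : E → F →L[ℝ] ℝ) (z : E) :
    E →L[ℝ] F →L[ℝ] F :=
  Γ z + ((ρ z).comp (φ z)).smulRight (.id ℝ F) + (smulRightL ℝ F F (ρ z)).comp (φ z)

/-- The tensor `∇ρ - (ρ ∘ φ) ⊗ ρ`. -/
def projectiveTensor (Γ : E → E →L[ℝ] F →L[ℝ] F) (φ : E → E →L[ℝ] F) (ρ : E → F →L[ℝ] ℝ) (z : E) :
    E →L[ℝ] F →L[ℝ] ℝ :=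
  fderiv ℝ ρ z - (compL ℝ F F ℝ (ρ z)).comp (Γ z) - ((ρ z).comp (φ z)).smulRight (ρ z)

/-- The right-hand side of the equation `∇ρ = (ρ ∘ φ) ⊗ ρ + B`, solved for `dρ`. -/
def projectiveSystem (Γ : E → E →L[ℝ] F →L[ℝ] F) (φ : E → E →L[ℝ] F) (B : E → E →L[ℝ] F →L[ℝ] ℝ)
    (q : E × (F →L[ℝ] ℝ)) : E →L[ℝ] F →L[ℝ] ℝ :=
  B q.1 + (compL ℝ F F ℝ q.2).comp (Γ q.1) + (q.2.comp (φ q.1)).smulRight q.2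

/-- The local expression of relative torsion-freeness. -/
def LocallyTorsionFreeAt (Γ : E → E →L[ℝ] F →L[ℝ] F) (φ : E → E →L[ℝ] F) (z : E) : Prop :=
  ∀ h k, fderiv ℝ φ z h k + Γ z h (φ z k) = fderiv ℝ φ z k h + Γ z k (φ z h)

variable {Γ : E → E →L[ℝ] F →L[ℝ] F} {φ : E → E →L[ℝ] F} {ρ : E → F →L[ℝ] ℝ}
  {B : E → E →L[ℝ] F →L[ℝ] ℝ} {z : E}

@[simp]
theorem localCurvature_apply (h k : E) (f : F) : localCurvature Γ z h k f =
    fderiv ℝ Γ z h k f - fderiv ℝ Γ z k h f + Γ z h (Γ z k f) - Γ z k (Γ z h f) := rfl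

@[simp]
theorem projectiveChange_apply (h : E) (f : F) :
    projectiveChange Γ φ ρ z h f = Γ z h f + ρ z (φ z h) • f + ρ z f • φ z h := by
  simp [projectiveChange]

@[simp]
theorem projectiveTensor_apply (h : E) (f : F) : projectiveTensor Γ φ ρ z h f =
    fderiv ℝ ρ z h f - ρ z (Γ z h f) - ρ z (φ z h) * ρ z f := by
  simp [projectiveTensor]

@[simp]
theorem projectiveSystem_apply (q : E × (F →L[ℝ] ℝ)) (h : E) (f : F) :
    projectiveSystem Γ φ B q h f = B q.1 h f + q.2 (Γ q.1 h f) + q.2 (φ q.1 h) * q.2 f := by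
  simp [projectiveSystem]

/-- A basis of the finite-dimensional source identifies operators with tuples of vectors. Smoothness
of the operator-valued expressions above can thus be checked on their evaluated forms. -/
theorem contDiffAt_clm_apply {X G : Type*} [NormedAddCommGroup X] [NormedSpace ℝ X]
    [NormedAddCommGroup G] [NormedSpace ℝ G] [FiniteDimensional ℝ E] {n : ℕ∞ω}
    {T : X → E →L[ℝ] G} {x : X} :
    ContDiffAt ℝ n T x ↔ ∀ y, ContDiffAt ℝ n (fun x ↦ T x y) x := by
  refine ⟨fun h y ↦ h.clm_apply contDiffAt_const, fun h ↦ ?_⟩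
  let d := Module.finrank ℝ E
  have hd : d = Module.finrank ℝ (Fin d → ℝ) := (Module.finrank_fin_fun ℝ).symm
  let e₁ := ContinuousLinearEquiv.ofFinrankEq hd
  let e₂ := (e₁.arrowCongr (.refl ℝ G)).trans (.piRing (Fin d))
  rw [← Function.id_comp T, ← e₂.symm_comp_self]
  exact e₂.symm.contDiff.contDiffAt.comp x (contDiffAt_pi.mpr fun i ↦ h _)

theorem ContDiffAt.projectiveChange [FiniteDimensional ℝ E] [FiniteDimensional ℝ F] {n : ℕ∞ω}
    (hΓ : ContDiffAt ℝ n Γ z) (hφ : ContDiffAt ℝ n φ z) (hρ : ContDiffAt ℝ n ρ z) :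
    ContDiffAt ℝ n (projectiveChange Γ φ ρ) z := by
  refine contDiffAt_clm_apply.2 fun h ↦ contDiffAt_clm_apply.2 fun f ↦ ?_
  simp only [projectiveChange_apply]
  fun_prop

theorem ContDiffAt.projectiveTensor [FiniteDimensional ℝ E] [FiniteDimensional ℝ F]
    (hΓ : ContDiffAt ℝ ∞ Γ z) (hφ : ContDiffAt ℝ ∞ φ z) (hρ : ContDiffAt ℝ ∞ ρ z) :
    ContDiffAt ℝ ∞ (projectiveTensor Γ φ ρ) z := by
  refine contDiffAt_clm_apply.2 fun h ↦ contDiffAt_clm_apply.2 fun f ↦ ?_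
  simp only [projectiveTensor_apply]
  have := hρ.fderiv_right (m := ∞) (by simp)
  fun_prop

theorem ContDiffAt.projectiveSystem [FiniteDimensional ℝ E] [FiniteDimensional ℝ F] {n : ℕ∞ω}
    {q : E × (F →L[ℝ] ℝ)} (hΓ : ContDiffAt ℝ n Γ q.1) (hφ : ContDiffAt ℝ n φ q.1)
    (hB : ContDiffAt ℝ n B q.1) : ContDiffAt ℝ n (projectiveSystem Γ φ B) q := by
  refine contDiffAt_clm_apply.2 fun h ↦ contDiffAt_clm_apply.2 fun f ↦ ?_
  simp only [projectiveSystem_apply]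
  have hΓ := hΓ.comp q contDiffAt_fst
  have hφ := hφ.comp q contDiffAt_fst
  have hB := hB.comp q contDiffAt_fst
  simp only [Function.comp_def] at hΓ hφ hB
  fun_prop

theorem fderiv_clm_apply₂ {X G₁ G₂ G₃ : Type*} [NormedAddCommGroup X] [NormedSpace ℝ X]
    [NormedAddCommGroup G₁] [NormedSpace ℝ G₁] [NormedAddCommGroup G₂] [NormedSpace ℝ G₂]
    [NormedAddCommGroup G₃] [NormedSpace ℝ G₃] {T : X → G₁ →L[ℝ] G₂ →L[ℝ] G₃} {x : X}
    (hT : DifferentiableAt ℝ T x) (v : X) (a : G₁) (b : G₂) :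
    fderiv ℝ T x v a b = fderiv ℝ (fun y ↦ T y a b) x v := by
  have := ((hT.hasFDerivAt.clm_apply (hasFDerivAt_const a x)).clm_apply
    (hasFDerivAt_const b x)).fderiv
  simp [this]

theorem fderiv_projectiveChange_apply [FiniteDimensional ℝ E] [FiniteDimensional ℝ F]
    (hΓ : ContDiffAt ℝ 1 Γ z) (hφ : ContDiffAt ℝ 1 φ z) (hρ : ContDiffAt ℝ 1 ρ z)
    (h k : E) (f : F) :
    fderiv ℝ (projectiveChange Γ φ ρ) z h k f = fderiv ℝ Γ z h k f +
      (fderiv ℝ ρ z h (φ z k) + ρ z (fderiv ℝ φ z h k)) • f + fderiv ℝ ρ z h f • φ z k +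
      ρ z f • fderiv ℝ φ z h k := by
  have hd := (hΓ.projectiveChange hφ hρ).differentiableAt one_ne_zero
  replace hΓ := (hΓ.differentiableAt one_ne_zero).hasFDerivAt
  replace hφ := (hφ.differentiableAt one_ne_zero).hasFDerivAt
  replace hρ := (hρ.differentiableAt one_ne_zero).hasFDerivAt
  have h1 := (hΓ.clm_apply (hasFDerivAt_const k z)).clm_apply (hasFDerivAt_const f z)
  have h2 := hφ.clm_apply (hasFDerivAt_const k z)
  have h3 := hρ.clm_apply (hasFDerivAt_const f z)
  have := ((h1.add ((hρ.clm_apply h2).smul_const f)).add (h3.smul h2)).fderiv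
  rw [fderiv_clm_apply₂ hd]
  simp only [projectiveChange_apply]
  refine (congr($this h)).trans ?_
  simp
  module

/-- Product rule in both variables: the terms with `τ` come from the variation of the unknown
covector, the others from that of the base point. -/
theorem fderiv_projectiveSystem_apply [FiniteDimensional ℝ E] [FiniteDimensional ℝ F]
    {q : E × (F →L[ℝ] ℝ)} (hΓ : ContDiffAt ℝ 1 Γ q.1) (hφ : ContDiffAt ℝ 1 φ q.1)
    (hB : ContDiffAt ℝ 1 B q.1) (h k : E) (τ : F →L[ℝ] ℝ) (f : F) :
    fderiv ℝ (projectiveSystem Γ φ B) q (h, τ) k f = fderiv ℝ B q.1 h k f +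
      (τ (Γ q.1 k f) + q.2 (fderiv ℝ Γ q.1 h k f)) +
      (τ (φ q.1 k) + q.2 (fderiv ℝ φ q.1 h k)) * q.2 f + q.2 (φ q.1 k) * τ f := by
  have hd := (hΓ.projectiveSystem hφ hB).differentiableAt one_ne_zero
  replace hΓ := (hΓ.differentiableAt one_ne_zero).hasFDerivAt.comp q hasFDerivAt_fst
  replace hφ := (hφ.differentiableAt one_ne_zero).hasFDerivAt.comp q hasFDerivAt_fst
  replace hB := (hB.differentiableAt one_ne_zero).hasFDerivAt.comp q hasFDerivAt_fst
  have hs := hasFDerivAt_snd (𝕜 := ℝ) (p := q)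
  have h1 := (hΓ.clm_apply (hasFDerivAt_const k q)).clm_apply (hasFDerivAt_const f q)
  have h2 := hφ.clm_apply (hasFDerivAt_const k q)
  have h3 := (hB.clm_apply (hasFDerivAt_const k q)).clm_apply (hasFDerivAt_const f q)
  have := ((h3.add (hs.clm_apply h1)).add
    ((hs.clm_apply h2).mul (hs.clm_apply (hasFDerivAt_const f q)))).fderiv
  rw [fderiv_clm_apply₂ hd]
  simp only [projectiveSystem_apply]
  refine (congr($this (h, τ))).trans ?_
  simp
  ring

theorem fderiv_projectiveTensor_apply [FiniteDimensional ℝ E] [FiniteDimensional ℝ F]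
    (hΓ : ContDiffAt ℝ ∞ Γ z) (hφ : ContDiffAt ℝ ∞ φ z) (hρ : ContDiffAt ℝ ∞ ρ z)
    (h k : E) (f : F) :
    fderiv ℝ (projectiveTensor Γ φ ρ) z h k f = fderiv ℝ (fderiv ℝ ρ) z h k f -
      (fderiv ℝ ρ z h (Γ z k f) + ρ z (fderiv ℝ Γ z h k f)) -
      ((fderiv ℝ ρ z h (φ z k) + ρ z (fderiv ℝ φ z h k)) * ρ z f +
        ρ z (φ z k) * fderiv ℝ ρ z h f) := by
  have hd := (hΓ.projectiveTensor hφ hρ).differentiableAt (by simp)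
  have hρ' := ((hρ.fderiv_right (m := ∞) (by simp)).differentiableAt (by simp)).hasFDerivAt
  replace hΓ := (hΓ.differentiableAt (by simp)).hasFDerivAt
  replace hφ := (hφ.differentiableAt (by simp)).hasFDerivAt
  replace hρ := (hρ.differentiableAt (by simp)).hasFDerivAt
  have h1 := (hΓ.clm_apply (hasFDerivAt_const k z)).clm_apply (hasFDerivAt_const f z)
  have h2 := hφ.clm_apply (hasFDerivAt_const k z)
  have h3 := (hρ'.clm_apply (hasFDerivAt_const k z)).clm_apply (hasFDerivAt_const f z)
  have := ((h3.sub (hρ.clm_apply h1)).sub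
    ((hρ.clm_apply h2).mul (hρ.clm_apply (hasFDerivAt_const f z)))).fderiv
  rw [fderiv_clm_apply₂ hd]
  simp only [projectiveTensor_apply]
  refine (congr($this h)).trans ?_
  simp
  ring

/-- The curvature of a projectively changed connection. -/
theorem localCurvature_projectiveChange [FiniteDimensional ℝ E]
    [FiniteDimensional ℝ F] (hΓ : ContDiffAt ℝ 1 Γ z) (hφ : ContDiffAt ℝ 1 φ z)
    (hρ : ContDiffAt ℝ 1 ρ z) (htor : LocallyTorsionFreeAt Γ φ z) (h k : E) (f : F) :
    localCurvature (projectiveChange Γ φ ρ) z h k f = localCurvature Γ z h k f +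
      (projectiveTensor Γ φ ρ z h (φ z k) - projectiveTensor Γ φ ρ z k (φ z h)) • f +
      projectiveTensor Γ φ ρ z h f • φ z k - projectiveTensor Γ φ ρ z k f • φ z h := by
  have ht := htor h k
  -- Torsion-freeness removes the antisymmetric part of the derivative of `φ`, the only derivative
  -- of `φ` left after antisymmetrising.
  have ht' : fderiv ℝ φ z h k = fderiv ℝ φ z k h + Γ z k (φ z h) - Γ z h (φ z k) := by
    rw [← ht]; abel
  simp only [localCurvature_apply, fderiv_projectiveChange_apply hΓ hφ hρ, projectiveChange_apply,
    projectiveTensor_apply, map_add, map_smul, ht', map_sub]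
  module

/-- Symmetry of the second derivative gives the Ricci identity: antisymmetrising ∇∇ρ leaves -ρ∘R,
which `hcurv` writes through P. The exterior derivative of ρ∘φ vanishes by torsion-freeness and
symmetry of P, and the remaining terms from (ρ∘φ) ⊗ ρ cancel -ρ∘R. -/
theorem projectiveTensor_codazzi [FiniteDimensional ℝ E] [FiniteDimensional ℝ F]
    (hΓ : ContDiffAt ℝ ∞ Γ z) (hφ : ContDiffAt ℝ ∞ φ z)
    (hρ : ContDiffAt ℝ ∞ ρ z) (htor : LocallyTorsionFreeAt Γ φ z)
    (hsymm : ∀ h k, projectiveTensor Γ φ ρ z h (φ z k) = projectiveTensor Γ φ ρ z k (φ z h))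
    (hcurv : ∀ h k f, localCurvature Γ z h k f =
      projectiveTensor Γ φ ρ z k f • φ z h - projectiveTensor Γ φ ρ z h f • φ z k)
    (h k : E) (f : F) :
    fderiv ℝ (projectiveTensor Γ φ ρ) z h k f - fderiv ℝ (projectiveTensor Γ φ ρ) z k h f =
      projectiveTensor Γ φ ρ z k (Γ z h f) - projectiveTensor Γ φ ρ z h (Γ z k f) := by
  have h2 : fderiv ℝ (fderiv ℝ ρ) z h k f = fderiv ℝ (fderiv ℝ ρ) z k h f := by
    rw [((hρ.of_le (WithTop.coe_le_coe.2 (le_top : (2 : ℕ∞) ≤ ⊤))).isSymmSndFDerivAt (by simp)) h k]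
  have ht := congr(ρ z $(htor h k))
  have hs := hsymm h k
  have hc := congr(ρ z $(hcurv h k f))
  simp only [fderiv_projectiveTensor_apply hΓ hφ hρ]
  simp only [localCurvature_apply, projectiveTensor_apply, map_add, map_sub, map_smul,
    smul_eq_mul] at *
  linear_combination h2 - hc - ρ z f * ht - ρ z f * hs

/-- The Codazzi computation read backwards. At an arbitrary covector `q.2`, the difference of the
two mixed derivatives is a combination of the Codazzi equation, `q.2` of the curvature equation, and
`q.2 f` times torsion-freeness and symmetry. -/
theorem projectiveSystem_integrable [FiniteDimensional ℝ E] [FiniteDimensional ℝ F]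
    {q : E × (F →L[ℝ] ℝ)} (hΓ : ContDiffAt ℝ 1 Γ q.1) (hφ : ContDiffAt ℝ 1 φ q.1)
    (hB : ContDiffAt ℝ 1 B q.1)
    (htor : LocallyTorsionFreeAt Γ φ q.1)
    (hsymm : ∀ h k, B q.1 h (φ q.1 k) = B q.1 k (φ q.1 h))
    (hcurv : ∀ h k f, localCurvature Γ q.1 h k f = B q.1 k f • φ q.1 h - B q.1 h f • φ q.1 k)
    (hcod : ∀ h k f, fderiv ℝ B q.1 h k f - fderiv ℝ B q.1 k h f =
      B q.1 k (Γ q.1 h f) - B q.1 h (Γ q.1 k f)) (h k : E) :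
    fderiv ℝ (projectiveSystem Γ φ B) q (h, projectiveSystem Γ φ B q h) k =
      fderiv ℝ (projectiveSystem Γ φ B) q (k, projectiveSystem Γ φ B q k) h := by
  ext f
  have ht := congr(q.2 $(htor h k))
  have hs := hsymm h k
  have hc := congr(q.2 $(hcurv h k f))
  have hcod := hcod h k f
  simp only [fderiv_projectiveSystem_apply hΓ hφ hB]
  simp only [localCurvature_apply, projectiveSystem_apply, map_add, map_sub, map_smul,
    smul_eq_mul] at *
  linear_combination hcod + hc + q.2 f * ht + q.2 f * hs

/-- A rank-one map `f ↦ b f • v` has trace `b v`. This formula links trace-free curvature to the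
symmetry of P in one direction and of B in the other. -/
theorem trace_eq_of_apply_eq [FiniteDimensional ℝ F] {L : F →ₗ[ℝ] F} {β : ℝ} {b₁ b₂ : F →L[ℝ] ℝ}
    {v₁ v₂ : F} (hL : ∀ f, L f = β • f + b₁ f • v₁ - b₂ f • v₂) :
    LinearMap.trace ℝ F L = β * Module.finrank ℝ F + b₁ v₁ - b₂ v₂ := by
  have : L = β • LinearMap.id + (b₁ : F →ₗ[ℝ] ℝ).smulRight v₁ - (b₂ : F →ₗ[ℝ] ℝ).smulRight v₂ := by
    ext f
    simp [hL]
  simp [this]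

end LocalConnections

/-! ### Sections in a local trivialization, and global extension of germs -/

section BundleCoordinates

open Filter Topology

set_option linter.unusedSectionVars false

variable {n : ℕ} {M : Type*} [TopologicalSpace M] [ChartedSpace (EuclideanSpace ℝ (Fin n)) M]
  (F : Type*) [NormedAddCommGroup F] [NormedSpace ℝ F]
  (V : M → Type*) [TopologicalSpace (TotalSpace F V)]
  [∀ x, AddCommGroup (V x)] [∀ x, Module ℝ (V x)] [∀ x, TopologicalSpace (V x)]
  [FiberBundle F V] [VectorBundle ℝ F V]

/-- `σ` is a section that is smooth at the point `x`. -/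
def SmoothSectionAt {V : M → Type*} [TopologicalSpace (TotalSpace F V)]
    [∀ x, TopologicalSpace (V x)] [FiberBundle F V] (σ : Π x : M, V x) (x : M) : Prop :=
  ContMDiffAt (𝓡 n) ((𝓡 n).prod 𝓘(ℝ, F)) ∞ (fun x ↦ TotalSpace.mk' F x (σ x)) x

/-- The fibre coordinate at `x` in the preferred trivialization at `p`. -/
def fiberCoord (p x : M) : V x →L[ℝ] F := (trivializationAt F V p).continuousLinearMapAt ℝ x

/-- The frame at `x` given by the preferred trivialization at `p`. -/
def fiberFrame (p x : M) : F →L[ℝ] V x := (trivializationAt F V p).symmL ℝ x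

/-- The points at which both the chart and the trivialization at `p` are defined. -/
def coordDomain (p : M) : Set M :=
  (chartAt (EuclideanSpace ℝ (Fin n)) p).source ∩ (trivializationAt F V p).baseSet

theorem isOpen_coordDomain (p : M) : IsOpen (coordDomain (n := n) F V p) :=
  (chartAt _ p).open_source.inter (trivializationAt F V p).open_baseSet

theorem mem_coordDomain_self (p : M) : p ∈ coordDomain (n := n) F V p :=
  ⟨mem_chart_source _ p, FiberBundle.mem_baseSet_trivializationAt F V p⟩

variable {F V} {p x : M} {σ : Π x : M, V x}

theorem fiberCoord_fiberFrame (hx : x ∈ (trivializationAt F V p).baseSet) (f : F) :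
    fiberCoord F V p x (fiberFrame F V p x f) = f :=
  (trivializationAt F V p).continuousLinearMapAt_symmL hx f

theorem fiberFrame_fiberCoord (hx : x ∈ (trivializationAt F V p).baseSet) (v : V x) :
    fiberFrame F V p x (fiberCoord F V p x v) = v :=
  (trivializationAt F V p).symmL_continuousLinearMapAt hx v

theorem eventually_mem_baseSet (hx : x ∈ (trivializationAt F V p).baseSet) :
    ∀ᶠ y in 𝓝 x, y ∈ (trivializationAt F V p).baseSet :=
  (trivializationAt F V p).open_baseSet.mem_nhds hx

theorem fiberCoord_apply (hx : x ∈ (trivializationAt F V p).baseSet) (v : V x) :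
    fiberCoord F V p x v = (trivializationAt F V p ⟨x, v⟩).2 := by
  simp [fiberCoord, Trivialization.coe_linearMapAt_of_mem _ hx]

/-- The trivialization is the one at a fixed `p`, not at `x`, so that a single coordinate system
serves a whole neighbourhood of `p`. -/
theorem smoothSectionAt_iff [ContMDiffVectorBundle ∞ F V (𝓡 n)]
    (hx : x ∈ (trivializationAt F V p).baseSet) :
    SmoothSectionAt (n := n) F σ x ↔
      ContMDiffAt (𝓡 n) 𝓘(ℝ, F) ∞ (fun y ↦ fiberCoord F V p y (σ y)) x := by
  rw [SmoothSectionAt, (trivializationAt F V p).contMDiffAt_section_iff hx]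
  exact Filter.EventuallyEq.contMDiffAt_iff
    ((eventually_mem_baseSet hx).mono fun y hy ↦ (fiberCoord_apply hy _).symm)

theorem mdifferentiableAt_section_iff_fiberCoord [ContMDiffVectorBundle 1 F V (𝓡 n)]
    (hx : x ∈ (trivializationAt F V p).baseSet) :
    MDifferentiableAt (𝓡 n) ((𝓡 n).prod 𝓘(ℝ, F)) (fun y ↦ TotalSpace.mk' F y (σ y)) x ↔
      MDifferentiableAt (𝓡 n) 𝓘(ℝ, F) (fun y ↦ fiberCoord F V p y (σ y)) x := by
  rw [(trivializationAt F V p).mdifferentiableAt_section_iff (𝓡 n) σ hx]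
  exact Filter.EventuallyEq.mdifferentiableAt_iff
    ((eventually_mem_baseSet hx).mono fun y hy ↦ (fiberCoord_apply hy _).symm)

theorem SmoothSectionAt.mdifferentiableAt (hσ : SmoothSectionAt (n := n) F σ x) :
    MDifferentiableAt (𝓡 n) ((𝓡 n).prod 𝓘(ℝ, F)) (fun y ↦ TotalSpace.mk' F y (σ y)) x :=
  ContMDiffAt.mdifferentiableAt hσ (by simp)

theorem smoothSectionAt_fiberFrame [ContMDiffVectorBundle ∞ F V (𝓡 n)]
    (hx : x ∈ (trivializationAt F V p).baseSet) (f : F) :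
    SmoothSectionAt (n := n) F (fun y ↦ fiberFrame F V p y f) x := by
  rw [smoothSectionAt_iff hx]
  exact contMDiffAt_const.congr_of_eventuallyEq
    ((eventually_mem_baseSet hx).mono fun y hy ↦ fiberCoord_fiberFrame hy f)

/-- Every germ of a smooth section is the germ of a global smooth section. -/
theorem exists_smoothSection_eventuallyEq [T2Space M] [IsManifold (𝓡 n) ∞ M]
    (hσ : ∀ᶠ y in 𝓝 x, SmoothSectionAt (n := n) F σ y) :
    ∃ τ : Π x : M, V x, SmoothSection n F τ ∧ ∀ᶠ y in 𝓝 x, τ y = σ y := by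
  obtain ⟨u, hu, huo, hxu⟩ := eventually_nhds_iff.1 hσ
  obtain ⟨f, hf, -⟩ := (SmoothBumpFunction.nhds_basis_support (I := 𝓡 n)
    (huo.mem_nhds hxu)).mem_iff.1 (huo.mem_nhds hxu)
  -- Cutting `σ` off by a bump function whose closed support lies in the open set where `σ` is
  -- smooth.
  refine ⟨fun y ↦ f y • σ y, ContMDiffOn.smul_section_of_tsupport f.contMDiff.contMDiffOn huo hf
    (fun y hy ↦ (hu y hy).contMDiffWithinAt), ?_⟩
  filter_upwards [f.eventuallyEq_one] with y hy
  simp [hy]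

theorem contMDiffAt_clm_apply {G₁ G₂ : Type*} [NormedAddCommGroup G₁] [NormedSpace ℝ G₁]
    [FiniteDimensional ℝ G₁] [NormedAddCommGroup G₂] [NormedSpace ℝ G₂] {m : ℕ∞ω}
    {T : M → G₁ →L[ℝ] G₂} :
    ContMDiffAt (𝓡 n) 𝓘(ℝ, G₁ →L[ℝ] G₂) m T x ↔
      ∀ g, ContMDiffAt (𝓡 n) 𝓘(ℝ, G₂) m (fun y ↦ T y g) x := by
  refine ⟨fun h g ↦ h.clm_apply contMDiffAt_const, fun h ↦ ?_⟩
  let d := Module.finrank ℝ G₁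
  have hd : d = Module.finrank ℝ (Fin d → ℝ) := (Module.finrank_fin_fun ℝ).symm
  let e₁ := ContinuousLinearEquiv.ofFinrankEq hd
  let e₂ := (e₁.arrowCongr (.refl ℝ G₂)).trans (.piRing (Fin d))
  rw [← Function.id_comp T, ← e₂.symm_comp_self]
  exact e₂.symm.contDiff.contMDiff.contMDiffAt.comp x (contMDiffAt_pi_space.mpr fun i ↦ h _)

/-- A section of a bundle of homomorphisms is smooth if it maps the frame of a trivialization to
smooth sections. -/
theorem smoothSectionAt_hom_iff [FiniteDimensional ℝ F] [ContMDiffVectorBundle ∞ F V (𝓡 n)]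
    {F₂ : Type*} [NormedAddCommGroup F₂] [NormedSpace ℝ F₂] {V₂ : M → Type*}
    [TopologicalSpace (TotalSpace F₂ V₂)] [∀ x, AddCommGroup (V₂ x)] [∀ x, Module ℝ (V₂ x)]
    [∀ x, TopologicalSpace (V₂ x)] [∀ x, IsTopologicalAddGroup (V₂ x)]
    [∀ x, ContinuousSMul ℝ (V₂ x)] [FiberBundle F₂ V₂] [VectorBundle ℝ F₂ V₂]
    [ContMDiffVectorBundle ∞ F₂ V₂ (𝓡 n)] {ϕ : Π x : M, V x →L[ℝ] V₂ x}
    (hx : x ∈ (trivializationAt F V p).baseSet) :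
    SmoothSectionAt (n := n) (F →L[ℝ] F₂) ϕ x ↔
      ∀ f, SmoothSectionAt (n := n) F₂ (fun y ↦ ϕ y (fiberFrame F V p y f)) x := by
  refine ⟨fun h f ↦ h.clm_bundle_apply (smoothSectionAt_fiberFrame hx f), fun h ↦ ?_⟩
  have hx₂ : x ∈ (trivializationAt F₂ V₂ x).baseSet := FiberBundle.mem_baseSet_trivializationAt _ _ x
  rw [SmoothSectionAt, Trivialization.contMDiffAt_section_iff ((trivializationAt F V p
    ).continuousLinearMap (RingHom.id ℝ) (trivializationAt F₂ V₂ x)) ⟨hx, hx₂⟩]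
  simp only [Trivialization.continuousLinearMap_apply]
  exact contMDiffAt_clm_apply.2 fun f ↦ (smoothSectionAt_iff hx₂).1 (h f)

end BundleCoordinates

/-! ### Derivatives and Lie brackets in a chart -/

section ChartCoordinates

open Filter Topology

set_option linter.unusedSectionVars false

variable {n : ℕ} {M : Type*} [TopologicalSpace M] [ChartedSpace (EuclideanSpace ℝ (Fin n)) M]
  [IsManifold (𝓡 n) ∞ M]
  {F : Type*} [NormedAddCommGroup F] [NormedSpace ℝ F]
  {V : M → Type*} [TopologicalSpace (TotalSpace F V)]
  [∀ x, AddCommGroup (V x)] [∀ x, Module ℝ (V x)] [∀ x, TopologicalSpace (V x)]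
  [FiberBundle F V] [VectorBundle ℝ F V]
  {G : Type*} [NormedAddCommGroup G] [NormedSpace ℝ G]

/-- The coordinates of tangent vectors in the chart at `p`. -/
abbrev tangentCoord (p x : M) : TangentSpace (𝓡 n) x →L[ℝ] EuclideanSpace ℝ (Fin n) :=
  fiberCoord (EuclideanSpace ℝ (Fin n)) (TangentSpace (𝓡 n) : M → Type _) p x

/-- The coordinate frame of the tangent bundle in the chart at `p`. -/
abbrev tangentFrame (p x : M) : EuclideanSpace ℝ (Fin n) →L[ℝ] TangentSpace (𝓡 n) x :=
  fiberFrame (EuclideanSpace ℝ (Fin n)) (TangentSpace (𝓡 n) : M → Type _) p x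

variable (F) in
/-- The expression of the section `σ` in the chart and the trivialization at `p`. -/
def coordSection (p : M) (σ : Π x : M, V x) (z : EuclideanSpace ℝ (Fin n)) : F :=
  fiberCoord F V p ((extChartAt (𝓡 n) p).symm z) (σ ((extChartAt (𝓡 n) p).symm z))

/-- The expression of the vector field `X` in the chart at `p`. -/
abbrev coordField (p : M) (X : Π x : M, TangentSpace (𝓡 n) x) :
    EuclideanSpace ℝ (Fin n) → EuclideanSpace ℝ (Fin n) :=
  coordSection (EuclideanSpace ℝ (Fin n)) p X

variable {p x : M} {σ : Π x : M, V x} {X Y : Π x : M, TangentSpace (𝓡 n) x} {g : M → G}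

theorem extChartAt_symm_apply_self (hx : x ∈ (chartAt (EuclideanSpace ℝ (Fin n)) p).source) :
    (extChartAt (𝓡 n) p).symm (extChartAt (𝓡 n) p x) = x :=
  (extChartAt (𝓡 n) p).left_inv (by simpa using hx)

theorem continuousAt_extChartAt_symm_apply
    (hx : x ∈ (chartAt (EuclideanSpace ℝ (Fin n)) p).source) :
    Tendsto (extChartAt (𝓡 n) p).symm (𝓝 (extChartAt (𝓡 n) p x)) (𝓝 x) := by
  have := continuousAt_extChartAt_symm' (I := 𝓡 n) (x := p) (x' := x) (by simpa using hx)
  rwa [ContinuousAt, extChartAt_symm_apply_self hx] at this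

theorem continuousAt_extChartAt_apply
    (hx : x ∈ (chartAt (EuclideanSpace ℝ (Fin n)) p).source) :
    Tendsto (extChartAt (𝓡 n) p) (𝓝 x) (𝓝 (extChartAt (𝓡 n) p x)) :=
  continuousAt_extChartAt' (by simpa using hx)

theorem contMDiffAt_extChartAt_symm (hx : x ∈ (chartAt (EuclideanSpace ℝ (Fin n)) p).source) :
    ContMDiffAt 𝓘(ℝ, EuclideanSpace ℝ (Fin n)) (𝓡 n) ∞ (extChartAt (𝓡 n) p).symm
      (extChartAt (𝓡 n) p x) :=
  (contMDiffOn_extChartAt_symm p).contMDiffAt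
    ((isOpen_extChartAt_target p).mem_nhds ((extChartAt (𝓡 n) p).map_source (by simpa using hx)))

theorem eventually_extChartAt_right_inv
    (hx : x ∈ (chartAt (EuclideanSpace ℝ (Fin n)) p).source) :
    ∀ᶠ z in 𝓝 (extChartAt (𝓡 n) p x),
      extChartAt (𝓡 n) p ((extChartAt (𝓡 n) p).symm z) = z := by
  filter_upwards [(isOpen_extChartAt_target (I := 𝓡 n) p).mem_nhds
    ((extChartAt (𝓡 n) p).map_source (by simpa using hx))] with z hz
  exact (extChartAt (𝓡 n) p).right_inv hz

theorem contMDiffAt_iff_contDiffAt_chart {m : ℕ∞ω} (hm : m ≤ ∞)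
    (hx : x ∈ (chartAt (EuclideanSpace ℝ (Fin n)) p).source) :
    ContMDiffAt (𝓡 n) 𝓘(ℝ, G) m g x ↔
      ContDiffAt ℝ m (g ∘ (extChartAt (𝓡 n) p).symm) (extChartAt (𝓡 n) p x) := by
  rw [← contMDiffAt_iff_contDiffAt]
  constructor
  · intro h
    refine ContMDiffAt.comp _ ?_ ((contMDiffAt_extChartAt_symm hx).of_le hm)
    rwa [extChartAt_symm_apply_self hx]
  · intro h
    refine (h.comp x ((contMDiffAt_extChartAt' hx).of_le hm)).congr_of_eventuallyEq ?_
    filter_upwards [(chartAt _ p).open_source.mem_nhds hx] with y hy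
    exact (congrArg g (extChartAt_symm_apply_self hy)).symm

theorem mdifferentiableAt_iff_differentiableAt_chart
    (hx : x ∈ (chartAt (EuclideanSpace ℝ (Fin n)) p).source) :
    MDifferentiableAt (𝓡 n) 𝓘(ℝ, G) g x ↔
      DifferentiableAt ℝ (g ∘ (extChartAt (𝓡 n) p).symm) (extChartAt (𝓡 n) p x) := by
  rw [← mdifferentiableAt_iff_differentiableAt]
  constructor
  · intro h
    refine MDifferentiableAt.comp _ ?_ ((contMDiffAt_extChartAt_symm hx).mdifferentiableAt (by simp))
    rwa [extChartAt_symm_apply_self hx]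
  · intro h
    refine (h.comp x ((contMDiffAt_extChartAt' (n := ∞) hx).mdifferentiableAt
      (by simp))).congr_of_eventuallyEq ?_
    filter_upwards [(chartAt _ p).open_source.mem_nhds hx] with y hy
    exact (congrArg g (extChartAt_symm_apply_self hy)).symm

/-- This ties the trivialization of the tangent bundle to calculus, so that vector components are
derivatives of the chart and the chain rule applies. -/
theorem tangentCoord_eq_mfderiv (hx : x ∈ (chartAt (EuclideanSpace ℝ (Fin n)) p).source) :
    tangentCoord p x = mfderiv (𝓡 n) 𝓘(ℝ, EuclideanSpace ℝ (Fin n)) (extChartAt (𝓡 n) p) x :=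
  TangentBundle.continuousLinearMapAt_trivializationAt hx

theorem mvfderiv_eq_fderiv_chart (hx : x ∈ (chartAt (EuclideanSpace ℝ (Fin n)) p).source)
    (hg : MDifferentiableAt (𝓡 n) 𝓘(ℝ, G) g x) (v : TangentSpace (𝓡 n) x) :
    mvfderiv (𝓡 n) g x v = fderiv ℝ (g ∘ (extChartAt (𝓡 n) p).symm) (extChartAt (𝓡 n) p x)
      (tangentCoord p x v) := by
  have h := (mdifferentiableAt_iff_differentiableAt_chart hx).1 hg
  have hc : HasMFDerivAt (𝓡 n) 𝓘(ℝ, EuclideanSpace ℝ (Fin n)) (extChartAt (𝓡 n) p) x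
      (tangentCoord p x) := by
    rw [tangentCoord_eq_mfderiv hx]
    exact ((contMDiffAt_extChartAt' (I := 𝓡 n) (n := ∞) hx).mdifferentiableAt
      (by simp)).hasMFDerivAt
  have h2 := (h.hasFDerivAt.hasMFDerivAt.comp x hc).congr_of_eventuallyEq (f₁ := g) (by
    filter_upwards [(chartAt _ p).open_source.mem_nhds hx] with y hy
    exact (congrArg g (extChartAt_symm_apply_self hy)).symm)
  exact congrArg (fun T ↦ T v) h2.mfderiv

theorem smoothSectionAt_iff_coordSection [ContMDiffVectorBundle ∞ F V (𝓡 n)]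
    (hx : x ∈ coordDomain (n := n) F V p) :
    SmoothSectionAt (n := n) F σ x ↔
      ContDiffAt ℝ ∞ (coordSection F p σ) (extChartAt (𝓡 n) p x) := by
  rw [smoothSectionAt_iff hx.2, contMDiffAt_iff_contDiffAt_chart le_rfl hx.1]
  rfl

theorem mdifferentiableAt_section_iff_coordSection [ContMDiffVectorBundle 1 F V (𝓡 n)]
    (hx : x ∈ coordDomain (n := n) F V p) :
    MDifferentiableAt (𝓡 n) ((𝓡 n).prod 𝓘(ℝ, F)) (fun y ↦ TotalSpace.mk' F y (σ y)) x ↔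
      DifferentiableAt ℝ (coordSection F p σ) (extChartAt (𝓡 n) p x) := by
  rw [mdifferentiableAt_section_iff_fiberCoord hx.2,
    mdifferentiableAt_iff_differentiableAt_chart hx.1]
  rfl

theorem coordSection_apply (hx : x ∈ (chartAt (EuclideanSpace ℝ (Fin n)) p).source) :
    coordSection F p σ (extChartAt (𝓡 n) p x) = fiberCoord F V p x (σ x) := by
  rw [coordSection, extChartAt_symm_apply_self hx]

/-- Each field is the pullback under the chart of its coordinate expression, and Lie brackets
commute with pullback. In the model space the bracket is the usual difference of directional
derivatives. -/
theorem tangentCoord_mlieBracket (hx : x ∈ (chartAt (EuclideanSpace ℝ (Fin n)) p).source)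
    (hX : MDifferentiableAt (𝓡 n) (𝓡 n).tangent (fun y ↦ (X y : TangentBundle (𝓡 n) M)) x)
    (hY : MDifferentiableAt (𝓡 n) (𝓡 n).tangent (fun y ↦ (Y y : TangentBundle (𝓡 n) M)) x) :
    tangentCoord p x (VectorField.mlieBracket (𝓡 n) X Y x) =
      fderiv ℝ (coordField p Y) (extChartAt (𝓡 n) p x) (tangentCoord p x (X x)) -
      fderiv ℝ (coordField p X) (extChartAt (𝓡 n) p x) (tangentCoord p x (Y x)) := by
  have : IsManifold (𝓡 n) (minSmoothness ℝ 2) M := by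
    rw [minSmoothness_of_isRCLikeNormedField]; infer_instance
  have : IsManifold 𝓘(ℝ, EuclideanSpace ℝ (Fin n)) (minSmoothness ℝ 2)
      (EuclideanSpace ℝ (Fin n)) := by
    rw [minSmoothness_of_isRCLikeNormedField]; infer_instance
  have hinv : ∀ y ∈ (chartAt (EuclideanSpace ℝ (Fin n)) p).source,
      (mfderiv (𝓡 n) 𝓘(ℝ, EuclideanSpace ℝ (Fin n)) (extChartAt (𝓡 n) p) y).IsInvertible :=
    fun y hy ↦ isInvertible_mfderiv_extChartAt (by simpa using hy)
  -- The coordinate expression, retyped as a vector field on the model space viewed as a manifold,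
  -- as `mpullback` requires.
  let Z' (Z : Π x : M, TangentSpace (𝓡 n) x) (z : EuclideanSpace ℝ (Fin n)) :
    TangentSpace 𝓘(ℝ, EuclideanSpace ℝ (Fin n)) z := coordField p Z z
  have hpull : ∀ Z : Π x : M, TangentSpace (𝓡 n) x,
      VectorField.mpullback (𝓡 n) 𝓘(ℝ, EuclideanSpace ℝ (Fin n)) (extChartAt (𝓡 n) p)
        (Z' Z) =ᶠ[𝓝 x] Z := fun Z ↦ by
    filter_upwards [(chartAt _ p).open_source.mem_nhds hx] with y hy
    refine (hinv y hy).inverse_apply_eq.2 ((coordSection_apply (F := EuclideanSpace ℝ (Fin n)) hy).trans ?_)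
    exact congrArg (fun T ↦ T (Z y)) (tangentCoord_eq_mfderiv hy)
  have hdiff : ∀ Z : Π x : M, TangentSpace (𝓡 n) x,
      MDifferentiableAt (𝓡 n) (𝓡 n).tangent (fun y ↦ (Z y : TangentBundle (𝓡 n) M)) x →
      MDifferentiableAt 𝓘(ℝ, EuclideanSpace ℝ (Fin n)) 𝓘(ℝ, EuclideanSpace ℝ (Fin n)).tangent
        (fun z ↦ (Z' Z z : TangentBundle 𝓘(ℝ, EuclideanSpace ℝ (Fin n)) (EuclideanSpace ℝ (Fin n))))
        (extChartAt (𝓡 n) p x) := fun Z hZ ↦ by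
    have h1 := (mdifferentiableAt_section_iff_coordSection ⟨hx, hx⟩).1 hZ
    have h2 := mdifferentiableAt_iff_differentiableAt.2 h1
    refine (mdifferentiableAt_section 𝓘(ℝ, EuclideanSpace ℝ (Fin n)) (Z' Z)).2 ?_
    simpa using h2
  have key := VectorField.mpullback_mlieBracket (I := 𝓡 n)
    (I' := 𝓘(ℝ, EuclideanSpace ℝ (Fin n))) (f := extChartAt (𝓡 n) p) (V := Z' X)
    (W := Z' Y) (x₀ := x) (n := ∞) (hdiff X hX) (hdiff Y hY) (contMDiffAt_extChartAt' hx) (by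
      rw [minSmoothness_of_isRCLikeNormedField]; exact WithTop.coe_le_coe.2 (le_top : (2 : ℕ∞) ≤ ⊤))
  rw [(hpull X).mlieBracket_vectorField_eq (hpull Y)] at key
  have key2 := (hinv x hx).inverse_apply_eq.1 key
  rw [← tangentCoord_eq_mfderiv hx] at key2
  refine key2.symm.trans ?_
  rw [← VectorField.mlieBracketWithin_univ]
  refine (congrFun VectorField.mlieBracketWithin_eq_lieBracketWithin _).trans ?_
  rw [VectorField.lieBracketWithin_univ, VectorField.lieBracket, ← coordSection_apply hx,
    ← coordSection_apply hx]

end ChartCoordinates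

/-! ### Christoffel symbols and the coordinate form of curvature -/

section CoordinateExpressions

open Filter Topology

set_option linter.unusedSectionVars false

variable {n : ℕ} {M : Type*} [TopologicalSpace M] [ChartedSpace (EuclideanSpace ℝ (Fin n)) M]
  [IsManifold (𝓡 n) ∞ M]
  {F : Type*} [NormedAddCommGroup F] [NormedSpace ℝ F] [FiniteDimensional ℝ F]
  {V : M → Type*} [TopologicalSpace (TotalSpace F V)]
  [∀ x, AddCommGroup (V x)] [∀ x, Module ℝ (V x)] [∀ x, TopologicalSpace (V x)]
  [∀ x, IsTopologicalAddGroup (V x)] [∀ x, ContinuousSMul ℝ (V x)]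
  [FiberBundle F V] [VectorBundle ℝ F V] [ContMDiffVectorBundle ∞ F V (𝓡 n)]

variable (F) in
/-- The coordinate expression of the bundle map `φ : TM → V`. -/
def coordHom (p : M) (φ : Π x : M, TangentSpace (𝓡 n) x →L[ℝ] V x)
    (z : EuclideanSpace ℝ (Fin n)) : EuclideanSpace ℝ (Fin n) →L[ℝ] F :=
  (fiberCoord F V p ((extChartAt (𝓡 n) p).symm z)).comp
    ((φ ((extChartAt (𝓡 n) p).symm z)).comp (tangentFrame p ((extChartAt (𝓡 n) p).symm z)))

variable (F) in
/-- The coordinate expression of a section of `T*M ⊗ V*`. -/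
def coordForm (p : M) (A : Π x : M, TangentSpace (𝓡 n) x →L[ℝ] V x →L[ℝ] ℝ)
    (z : EuclideanSpace ℝ (Fin n)) : EuclideanSpace ℝ (Fin n) →L[ℝ] F →L[ℝ] ℝ :=
  (ContinuousLinearMap.precomp ℝ (fiberFrame F V p ((extChartAt (𝓡 n) p).symm z))).comp
    ((A ((extChartAt (𝓡 n) p).symm z)).comp (tangentFrame p ((extChartAt (𝓡 n) p).symm z)))

variable (F) in
/-- The coordinate expression of a section of `V*`. -/
def coordCovector (p : M) (ρ : Π x : M, V x →L[ℝ] ℝ) (z : EuclideanSpace ℝ (Fin n)) : F →L[ℝ] ℝ :=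
  (ρ ((extChartAt (𝓡 n) p).symm z)).comp (fiberFrame F V p ((extChartAt (𝓡 n) p).symm z))

variable {p x : M} {σ : Π x : M, V x} {X Y : Π x : M, TangentSpace (𝓡 n) x}
  {φ : Π x : M, TangentSpace (𝓡 n) x →L[ℝ] V x}
  {A : Π x : M, TangentSpace (𝓡 n) x →L[ℝ] V x →L[ℝ] ℝ} {ρ : Π x : M, V x →L[ℝ] ℝ}
  {D : (Π x : M, V x) → Π x : M, TangentSpace (𝓡 n) x →L[ℝ] V x} {U : Set M}

theorem coordHom_apply (hx : x ∈ coordDomain (n := n) F V p) (v : TangentSpace (𝓡 n) x) :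
    coordHom F p φ (extChartAt (𝓡 n) p x) (tangentCoord p x v) = fiberCoord F V p x (φ x v) := by
  rw [coordHom, extChartAt_symm_apply_self hx.1]
  exact congrArg (fun w ↦ fiberCoord F V p x (φ x w)) (fiberFrame_fiberCoord hx.1 v)

theorem coordForm_apply (hx : x ∈ coordDomain (n := n) F V p) (v : TangentSpace (𝓡 n) x)
    (w : V x) :
    coordForm F p A (extChartAt (𝓡 n) p x) (tangentCoord p x v) (fiberCoord F V p x w) =
      A x v w := by
  rw [coordForm, extChartAt_symm_apply_self hx.1]
  change A x (tangentFrame p x (tangentCoord p x v))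
    (fiberFrame F V p x (fiberCoord F V p x w)) = A x v w
  rw [fiberFrame_fiberCoord hx.2]
  exact congrArg (fun u ↦ A x u w) (fiberFrame_fiberCoord hx.1 v)

theorem coordCovector_apply (hx : x ∈ coordDomain (n := n) F V p) (w : V x) :
    coordCovector F p ρ (extChartAt (𝓡 n) p x) (fiberCoord F V p x w) = ρ x w := by
  rw [coordCovector, extChartAt_symm_apply_self hx.1]
  exact congrArg (ρ x) (fiberFrame_fiberCoord hx.2 w)

theorem smoothSectionAt_trivial_iff {g : M → ℝ} :
    SmoothSectionAt (n := n) (V := fun _ ↦ ℝ) ℝ g x ↔ ContMDiffAt (𝓡 n) 𝓘(ℝ, ℝ) ∞ g x := by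
  rw [SmoothSectionAt, Bundle.contMDiffAt_section]
  rfl

theorem contDiffAt_coordHom_iff (hx : x ∈ coordDomain (n := n) F V p) :
    ContDiffAt ℝ ∞ (coordHom F p φ) (extChartAt (𝓡 n) p x) ↔
      SmoothSectionAt (n := n) (EuclideanSpace ℝ (Fin n) →L[ℝ] F) φ x := by
  rw [contDiffAt_clm_apply, smoothSectionAt_hom_iff (p := p) hx.1]
  exact forall_congr' fun h ↦ (smoothSectionAt_iff_coordSection
    (σ := fun y ↦ φ y (tangentFrame p y h)) hx).symm

theorem contDiffAt_coordCovector_iff (hx : x ∈ coordDomain (n := n) F V p) :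
    ContDiffAt ℝ ∞ (coordCovector F p ρ) (extChartAt (𝓡 n) p x) ↔
      SmoothSectionAt (n := n) (F →L[ℝ] ℝ) ρ x := by
  rw [contDiffAt_clm_apply, smoothSectionAt_hom_iff (V₂ := fun _ ↦ ℝ) (p := p) hx.2]
  exact forall_congr' fun h ↦ by
    rw [smoothSectionAt_trivial_iff, contMDiffAt_iff_contDiffAt_chart le_rfl hx.1]; rfl

/-- T*M ⊗ V* is the bundle Hom(TM, Hom(V, ℝ)), so the criterion for homomorphism bundles is used on
the outer factor and again, through `contDiffAt_coordCovector_iff`, on the inner one. -/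
theorem contDiffAt_coordForm_iff (hx : x ∈ coordDomain (n := n) F V p) :
    ContDiffAt ℝ ∞ (coordForm F p A) (extChartAt (𝓡 n) p x) ↔
      SmoothSectionAt (n := n) (EuclideanSpace ℝ (Fin n) →L[ℝ] F →L[ℝ] ℝ) A x := by
  rw [contDiffAt_clm_apply, smoothSectionAt_hom_iff (p := p) hx.1]
  refine forall_congr' fun h ↦ ?_
  rw [← contDiffAt_coordCovector_iff hx]
  rfl

theorem exists_smoothSection_eventuallyEq_fiberFrame [T2Space M]
    (hx : x ∈ (trivializationAt F V p).baseSet) (f : F) :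
    ∃ τ : Π x : M, V x, SmoothSection n F τ ∧ ∀ᶠ y in 𝓝 x, τ y = fiberFrame F V p y f :=
  exists_smoothSection_eventuallyEq
    ((eventually_mem_baseSet hx).mono fun _ hy ↦ smoothSectionAt_fiberFrame hy f)

/-- This turns a tensorial identity tested on global sections into an identity for arbitrary vectors
of one fibre. -/
theorem exists_smoothSection_apply_eq [T2Space M] (w : V x) :
    ∃ τ : Π x : M, V x, SmoothSection n F τ ∧ τ x = w := by
  have hx := FiberBundle.mem_baseSet_trivializationAt F V x
  obtain ⟨τ, hτ, hτx⟩ := exists_smoothSection_eventuallyEq_fiberFrame (n := n) hx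
    (fiberCoord F V x x w)
  exact ⟨τ, hτ, hτx.self_of_nhds.trans (fiberFrame_fiberCoord hx w)⟩

theorem exists_smoothVectorField_apply_eq [T2Space M] (v : TangentSpace (𝓡 n) x) :
    ∃ X : Π x : M, TangentSpace (𝓡 n) x, SmoothVectorField X ∧ X x = v :=
  exists_smoothSection_apply_eq (F := EuclideanSpace ℝ (Fin n)) v

/-- `Γ` is the Christoffel symbol of the connection `D` in the coordinates at `p`, at the point
`x`. -/
def IsChristoffelSymbolAt (p : M)
    (D : (Π x : M, V x) → Π x : M, TangentSpace (𝓡 n) x →L[ℝ] V x)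
    (Γ : EuclideanSpace ℝ (Fin n) → EuclideanSpace ℝ (Fin n) →L[ℝ] F →L[ℝ] F) (x : M) : Prop :=
  ∀ σ : Π x : M, V x,
    MDifferentiableAt (𝓡 n) ((𝓡 n).prod 𝓘(ℝ, F)) (fun y ↦ TotalSpace.mk' F y (σ y)) x →
    ∀ v : TangentSpace (𝓡 n) x, fiberCoord F V p x (D σ x v) =
      fderiv ℝ (coordSection F p σ) (extChartAt (𝓡 n) p x) (tangentCoord p x v) +
        Γ (extChartAt (𝓡 n) p x) (tangentCoord p x v) (fiberCoord F V p x (σ x))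

/-- The smoothness axiom concerns sections smooth on all of `U`. A germ is first extended to a
global section, and locality of covariant derivatives transfers the conclusion back. -/
theorem IsSmoothConnectionOn.smoothSectionAt [T2Space M] (hD : IsSmoothConnectionOn F D U)
    (hU : U ∈ 𝓝 x) (hσ : ∀ᶠ y in 𝓝 x, SmoothSectionAt (n := n) F σ y) :
    SmoothSectionAt (n := n) (EuclideanSpace ℝ (Fin n) →L[ℝ] F) (D σ) x := by
  obtain ⟨τ, hτ, hτσ⟩ := exists_smoothSection_eventuallyEq hσ
  have h := (hD.smooth.contMDiff (σ := τ) (ContMDiff.contMDiffOn hτ)).contMDiffAt hU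
  refine h.congr_of_eventuallyEq ?_
  filter_upwards [hτσ.eventually_nhds, hσ, eventually_mem_nhds_iff.2 hU] with y hy hσy hUy
  exact congrArg (TotalSpace.mk y) (hD.isCovariantDerivativeOn.congr_of_eventuallyEq
    hσy.mdifferentiableAt (hτ.contMDiffAt.mdifferentiableAt (by simp)) hUy
    (hy.mono fun z hz ↦ hz.symm))

variable (F V) in
/-- The flat connection given by the trivialization at `p`. -/
def trivializationConnection (p : M) (σ : Π x : M, V x) (x : M) : TangentSpace (𝓡 n) x →L[ℝ] V x :=
  (fiberFrame F V p x).comp (mvfderiv (𝓡 n) (fun y ↦ fiberCoord F V p y (σ y)) x)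

theorem isCovariantDerivativeOn_trivializationConnection (p : M) :
    IsCovariantDerivativeOn F (trivializationConnection F V (n := n) p)
      (trivializationAt F V p).baseSet where
  add {σ σ' x} hσ hσ' hx := by
    rw [mdifferentiableAt_section_iff_fiberCoord hx] at hσ hσ'
    ext v
    have := congrArg (fun T ↦ fiberFrame F V p x (T v)) (mvfderiv_add hσ hσ')
    simpa [trivializationConnection, Pi.add_def] using this
  leibniz {σ g x} hσ hg hx := by
    rw [mdifferentiableAt_section_iff_fiberCoord hx] at hσ
    ext v
    have := congrArg (fun T ↦ fiberFrame F V p x (T v)) (mvfderiv_smul hg hσ)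
    simpa [trivializationConnection, Pi.smul_def', fiberFrame_fiberCoord hx] using this

/-- A smooth connection has smooth Christoffel symbols. -/
theorem IsSmoothConnectionOn.exists_isChristoffelSymbolAt [T2Space M]
    (hD : IsSmoothConnectionOn F D U) (hU : IsOpen U) (p : M) :
    ∃ Γ : EuclideanSpace ℝ (Fin n) → EuclideanSpace ℝ (Fin n) →L[ℝ] F →L[ℝ] F,
      ∀ x ∈ U ∩ coordDomain (n := n) F V p, IsChristoffelSymbolAt p D Γ x ∧
        ContDiffAt ℝ ∞ Γ (extChartAt (𝓡 n) p x) := by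
  let s := U ∩ coordDomain (n := n) F V p
  have hs : IsOpen s := hU.inter (isOpen_coordDomain F V p)
  have h₁ : IsCovariantDerivativeOn F D s := hD.isCovariantDerivativeOn.mono inter_subset_left
  have h₀ : IsCovariantDerivativeOn F (trivializationConnection F V (n := n) p) s :=
    (isCovariantDerivativeOn_trivializationConnection p).mono fun x hx ↦ hx.2.2
  -- The difference of two connections is a tensor. Measured against the trivial connection and read
  -- in coordinates, it is the Christoffel symbol.
  let Δ (x : M) : V x →L[ℝ] TangentSpace (𝓡 n) x →L[ℝ] V x :=
    IsCovariantDerivativeOn.difference h₁ h₀ x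
  let γ (x : M) : EuclideanSpace ℝ (Fin n) →L[ℝ] F →L[ℝ] F :=
    (((ContinuousLinearMap.postcomp (EuclideanSpace ℝ (Fin n)) (fiberCoord F V p x)).comp
      ((ContinuousLinearMap.precomp (V x) (tangentFrame p x)).comp
        ((Δ x).comp (fiberFrame F V p x)))) : F →L[ℝ] EuclideanSpace ℝ (Fin n) →L[ℝ] F).flip
  have hΔ : ∀ x ∈ s, ∀ σ : Π x : M, V x,
      MDifferentiableAt (𝓡 n) ((𝓡 n).prod 𝓘(ℝ, F)) (fun y ↦ TotalSpace.mk' F y (σ y)) x →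
      Δ x (σ x) = D σ x - trivializationConnection F V p σ x :=
    fun x hx σ hσ ↦ IsCovariantDerivativeOn.difference_apply h₁ h₀ hx hσ
  -- The trivial connection annihilates the frame, so the Christoffel symbols are the coordinates of
  -- `D` applied to frame sections; their smoothness follows from that of `D`.
  have hframe : ∀ x ∈ s, ∀ f, Δ x (fiberFrame F V p x f) =
      D (fun y ↦ fiberFrame F V p y f) x := fun x hx f ↦ by
    have hsm := (smoothSectionAt_fiberFrame (n := n) hx.2.2 f).mdifferentiableAt
    have hc : (fun y ↦ fiberCoord F V p y (fiberFrame F V p y f)) ∘ (extChartAt (𝓡 n) p).symm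
        =ᶠ[𝓝 (extChartAt (𝓡 n) p x)] fun _ ↦ f := by
      filter_upwards [continuousAt_extChartAt_symm_apply hx.2.1 (eventually_mem_baseSet hx.2.2)]
        with z hz
      exact fiberCoord_fiberFrame hz f
    have h0 : trivializationConnection F V (n := n) p (fun y ↦ fiberFrame F V p y f) x = 0 := by
      ext v
      rw [trivializationConnection, ContinuousLinearMap.comp_apply, mvfderiv_eq_fderiv_chart hx.2.1
        ((mdifferentiableAt_section_iff_fiberCoord hx.2.2).1 hsm), hc.fderiv_eq]
      simp
    rw [hΔ x hx _ hsm, h0, sub_zero]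
  refine ⟨fun z ↦ γ ((extChartAt (𝓡 n) p).symm z), fun x hx ↦ ⟨fun σ hσ v ↦ ?_, ?_⟩⟩
  · have hγ : γ x (tangentCoord p x v) (fiberCoord F V p x (σ x)) =
        fiberCoord F V p x (Δ x (σ x) v) := by
      change fiberCoord F V p x (Δ x (fiberFrame F V p x (fiberCoord F V p x (σ x)))
        (tangentFrame p x (tangentCoord p x v))) = _
      rw [fiberFrame_fiberCoord hx.2.2]
      exact congrArg (fun u ↦ fiberCoord F V p x (Δ x (σ x) u)) (fiberFrame_fiberCoord hx.2.1 v)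
    have hd := mvfderiv_eq_fderiv_chart hx.2.1
      ((mdifferentiableAt_section_iff_fiberCoord hx.2.2).1 hσ) v
    beta_reduce
    rw [extChartAt_symm_apply_self hx.2.1, hγ, hΔ x hx σ hσ, sub_apply, map_sub,
      trivializationConnection, ContinuousLinearMap.comp_apply, fiberCoord_fiberFrame hx.2.2, hd]
    exact (add_sub_cancel _ _).symm
  · rw [contDiffAt_clm_apply]
    intro h
    rw [contDiffAt_clm_apply]
    intro f
    have hsm := hD.smoothSectionAt (hU.mem_nhds hx.1) ((eventually_mem_baseSet hx.2.2).mono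
      fun y hy ↦ smoothSectionAt_fiberFrame (n := n) hy f)
    refine (contDiffAt_clm_apply.1 ((contDiffAt_coordHom_iff hx.2).2 hsm) h).congr_of_eventuallyEq ?_
    filter_upwards [continuousAt_extChartAt_symm_apply hx.2.1 (hs.mem_nhds hx)] with z hz
    exact congrArg (fun T ↦ fiberCoord F V p _ (T (tangentFrame p _ h))) (hframe _ hz f)

theorem eventually_extChartAt_nhds {P : EuclideanSpace ℝ (Fin n) → M → Prop}
    (hx : x ∈ (chartAt (EuclideanSpace ℝ (Fin n)) p).source)
    (hP : ∀ᶠ y in 𝓝 x, P (extChartAt (𝓡 n) p y) y) :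
    ∀ᶠ z in 𝓝 (extChartAt (𝓡 n) p x), P z ((extChartAt (𝓡 n) p).symm z) := by
  filter_upwards [continuousAt_extChartAt_symm_apply hx hP, eventually_extChartAt_right_inv hx]
    with z hz hz'
  change P _ _ at hz
  rwa [hz'] at hz

theorem eventually_mem_coordDomain (hx : x ∈ coordDomain (n := n) F V p) :
    ∀ᶠ y in 𝓝 x, y ∈ coordDomain (n := n) F V p :=
  (isOpen_coordDomain F V p).mem_nhds hx

/-- Being of class `∞` at a point need not be an open condition, but being of class 1 is, hence the
passage to order one. -/
theorem SmoothSectionAt.eventually_mdifferentiableAt (hσ : SmoothSectionAt (n := n) F σ x) :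
    ∀ᶠ y in 𝓝 x,
      MDifferentiableAt (𝓡 n) ((𝓡 n).prod 𝓘(ℝ, F)) (fun y ↦ TotalSpace.mk' F y (σ y)) y :=
  (contMDiffAt_iff_contMDiffAt_nhds (by simp)).1 (ContMDiffAt.of_le (n := ∞) (m := 1) hσ (by simp))
    |>.mono fun y hy ↦ hy.mdifferentiableAt one_ne_zero

/-- The covariant derivative of the section with coordinates `s` along the vector field `Y`. -/
def localCovariantDerivative {E : Type*} [NormedAddCommGroup E] [NormedSpace ℝ E]
    (Γ : E → E →L[ℝ] F →L[ℝ] F) (s : E → F) (Y : E → E) (z : E) : F :=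
  fderiv ℝ s z (Y z) + Γ z (Y z) (s z)

theorem localCovariantDerivative_differentiableAt_and_fderiv {E : Type*} [NormedAddCommGroup E] [NormedSpace ℝ E]
    {Γ : E → E →L[ℝ] F →L[ℝ] F} {s : E → F} {Y : E → E} {z : E}
    (hΓ : ContDiffAt ℝ ∞ Γ z) (hs : ContDiffAt ℝ ∞ s z) (hY : ContDiffAt ℝ ∞ Y z) (h : E) :
    DifferentiableAt ℝ (localCovariantDerivative Γ s Y) z ∧
    fderiv ℝ (localCovariantDerivative Γ s Y) z h =
      fderiv ℝ (fderiv ℝ s) z h (Y z) + fderiv ℝ s z (fderiv ℝ Y z h) +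
        (fderiv ℝ Γ z h (Y z) (s z) + Γ z (fderiv ℝ Y z h) (s z) + Γ z (Y z) (fderiv ℝ s z h)) := by
  have h1 := ((hs.fderiv_right (m := ∞) (by simp)).differentiableAt (by simp)).hasFDerivAt
  have h2 := (hs.differentiableAt (by simp)).hasFDerivAt
  have h3 := (hY.differentiableAt (by simp)).hasFDerivAt
  have h4 := (hΓ.differentiableAt (by simp)).hasFDerivAt
  have h5 := (h1.clm_apply h3).add ((h4.clm_apply h3).clm_apply h2)
  refine ⟨h5.differentiableAt, (congr($(h5.fderiv) h)).trans ?_⟩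
  simp
  abel

/-- Second derivatives of `s` cancel by symmetry, derivatives of `X` and `Y` cancel against the
bracket term, and the mixed first-order terms cancel in pairs. Only terms of order zero in `s`
survive. -/
theorem localCurvature_eq {E : Type*} [NormedAddCommGroup E] [NormedSpace ℝ E]
    {Γ : E → E →L[ℝ] F →L[ℝ] F} {s : E → F} {X Y : E → E} {z : E}
    (hΓ : ContDiffAt ℝ ∞ Γ z) (hs : ContDiffAt ℝ ∞ s z) (hX : ContDiffAt ℝ ∞ X z)
    (hY : ContDiffAt ℝ ∞ Y z) :
    localCovariantDerivative Γ (localCovariantDerivative Γ s Y) X z -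
      localCovariantDerivative Γ (localCovariantDerivative Γ s X) Y z -
      localCovariantDerivative Γ s (fun z ↦ fderiv ℝ Y z (X z) - fderiv ℝ X z (Y z)) z =
    localCurvature Γ z (X z) (Y z) (s z) := by
  have hsymm : IsSymmSndFDerivAt ℝ s z := hs.isSymmSndFDerivAt (by
    rw [minSmoothness_of_isRCLikeNormedField]; exact WithTop.coe_le_coe.2 (le_top : (2 : ℕ∞) ≤ ⊤))
  have h := hsymm (X z) (Y z)
  rw [localCovariantDerivative, localCovariantDerivative, localCovariantDerivative,
    (localCovariantDerivative_differentiableAt_and_fderiv hΓ hs hY _).2,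
    (localCovariantDerivative_differentiableAt_and_fderiv hΓ hs hX _).2, localCurvature_apply, h]
  simp only [localCovariantDerivative, map_add, map_sub, sub_apply]
  abel

/-- Covariant derivatives in coordinates. -/
theorem IsChristoffelSymbolAt.coordSection_apply
    {Γ : EuclideanSpace ℝ (Fin n) → EuclideanSpace ℝ (Fin n) →L[ℝ] F →L[ℝ] F}
    (hD : IsChristoffelSymbolAt p D Γ x) (hx : x ∈ coordDomain (n := n) F V p)
    (hσ : MDifferentiableAt (𝓡 n) ((𝓡 n).prod 𝓘(ℝ, F)) (fun y ↦ TotalSpace.mk' F y (σ y)) x)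
    (Y : Π x : M, TangentSpace (𝓡 n) x) :
    fiberCoord F V p x (D σ x (Y x)) =
      localCovariantDerivative Γ (coordSection F p σ) (coordField p Y) (extChartAt (𝓡 n) p x) := by
  rw [hD σ hσ, localCovariantDerivative, _root_.coordSection_apply hx.1, coordField,
    _root_.coordSection_apply hx.1]

/-- The formula is needed as an equality of germs because curvature differentiates it once more. -/
theorem IsChristoffelSymbolAt.coordSection_eventuallyEq
    {Γ : EuclideanSpace ℝ (Fin n) → EuclideanSpace ℝ (Fin n) →L[ℝ] F →L[ℝ] F}
    (hD : ∀ᶠ y in 𝓝 x, IsChristoffelSymbolAt p D Γ y) (hx : x ∈ coordDomain (n := n) F V p)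
    (hσ : SmoothSectionAt (n := n) F σ x) (Y : Π x : M, TangentSpace (𝓡 n) x) :
    coordSection F p (fun y ↦ D σ y (Y y)) =ᶠ[𝓝 (extChartAt (𝓡 n) p x)]
      localCovariantDerivative Γ (coordSection F p σ) (coordField p Y) := by
  refine eventually_extChartAt_nhds (P := fun z y ↦ fiberCoord F V p y (D σ y (Y y)) =
    localCovariantDerivative Γ (coordSection F p σ) (coordField p Y) z) hx.1 ?_
  filter_upwards [hD, eventually_mem_coordDomain hx, hσ.eventually_mdifferentiableAt] with y h1 h2 h3
  exact h1.coordSection_apply h2 h3 Y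

/-- The curvature in coordinates. -/
theorem fiberCoord_curvature
    {Γ : EuclideanSpace ℝ (Fin n) → EuclideanSpace ℝ (Fin n) →L[ℝ] F →L[ℝ] F}
    (hD : ∀ᶠ y in 𝓝 x, IsChristoffelSymbolAt p D Γ y)
    (hΓ : ContDiffAt ℝ ∞ Γ (extChartAt (𝓡 n) p x)) (hx : x ∈ coordDomain (n := n) F V p)
    (hX : SmoothSectionAt (n := n) (EuclideanSpace ℝ (Fin n)) X x)
    (hY : SmoothSectionAt (n := n) (EuclideanSpace ℝ (Fin n)) Y x)
    (hσ : SmoothSectionAt (n := n) F σ x) :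
    fiberCoord F V p x (curvature D X Y σ x) = localCurvature Γ (extChartAt (𝓡 n) p x)
      (tangentCoord p x (X x)) (tangentCoord p x (Y x)) (fiberCoord F V p x (σ x)) := by
  have hσ' := (smoothSectionAt_iff_coordSection hx).1 hσ
  have hX' := (smoothSectionAt_iff_coordSection (p := p) ⟨hx.1, hx.1⟩).1 hX
  have hY' := (smoothSectionAt_iff_coordSection (p := p) ⟨hx.1, hx.1⟩).1 hY
  have key : ∀ Z : Π x : M, TangentSpace (𝓡 n) x,
      SmoothSectionAt (n := n) (EuclideanSpace ℝ (Fin n)) Z x → ∀ W : Π x : M, TangentSpace (𝓡 n) x,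
      fiberCoord F V p x (D (fun y ↦ D σ y (Z y)) x (W x)) =
        localCovariantDerivative Γ (localCovariantDerivative Γ (coordSection F p σ) (coordField p Z))
          (coordField p W) (extChartAt (𝓡 n) p x) := fun Z hZ W ↦ by
    have hZ' := (smoothSectionAt_iff_coordSection (p := p) ⟨hx.1, hx.1⟩).1 hZ
    have he := IsChristoffelSymbolAt.coordSection_eventuallyEq hD hx hσ Z
    rw [hD.self_of_nhds.coordSection_apply hx ((mdifferentiableAt_section_iff_coordSection hx).2
      ((localCovariantDerivative_differentiableAt_and_fderiv hΓ hσ' hZ' 0).1.congr_of_eventuallyEq he)) W,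
      localCovariantDerivative, he.fderiv_eq, he.self_of_nhds, ← localCovariantDerivative]
  rw [curvature, map_sub, map_sub, key Y hY X, key X hX Y,
    hD.self_of_nhds σ hσ.mdifferentiableAt, tangentCoord_mlieBracket hx.1 hX.mdifferentiableAt
    hY.mdifferentiableAt, ← coordSection_apply (F := EuclideanSpace ℝ (Fin n)) hx.1,
    ← coordSection_apply (F := EuclideanSpace ℝ (Fin n)) hx.1, ← coordSection_apply hx.1,
    ← localCurvature_eq hΓ hσ' hX' hY']
  rfl

end CoordinateExpressions

/-! ### Torsion, trace, curvature and Codazzi conditions at a point -/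

section PointwiseConditions

open Filter Topology

set_option linter.unusedSectionVars false

variable {n : ℕ} {M : Type*} [TopologicalSpace M] [ChartedSpace (EuclideanSpace ℝ (Fin n)) M]
  [IsManifold (𝓡 n) ∞ M]
  {F : Type*} [NormedAddCommGroup F] [NormedSpace ℝ F] [FiniteDimensional ℝ F]
  {V : M → Type*} [TopologicalSpace (TotalSpace F V)]
  [∀ x, AddCommGroup (V x)] [∀ x, Module ℝ (V x)] [∀ x, TopologicalSpace (V x)]
  [∀ x, IsTopologicalAddGroup (V x)] [∀ x, ContinuousSMul ℝ (V x)]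
  [FiberBundle F V] [VectorBundle ℝ F V] [ContMDiffVectorBundle ∞ F V (𝓡 n)]
  {p x : M} {σ : Π x : M, V x} {X Y : Π x : M, TangentSpace (𝓡 n) x}
  {φ : Π x : M, TangentSpace (𝓡 n) x →L[ℝ] V x}
  {A A' : Π x : M, TangentSpace (𝓡 n) x →L[ℝ] V x →L[ℝ] ℝ} {ρ : Π x : M, V x →L[ℝ] ℝ}
  {D : (Π x : M, V x) → Π x : M, TangentSpace (𝓡 n) x →L[ℝ] V x} {U : Set M}
  {Γ : EuclideanSpace ℝ (Fin n) → EuclideanSpace ℝ (Fin n) →L[ℝ] F →L[ℝ] F}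

theorem SmoothSection.smoothSectionAt (hσ : SmoothSection n F σ) (x : M) :
    SmoothSectionAt (n := n) F σ x :=
  ContMDiff.contMDiffAt hσ

theorem SmoothSectionOn.smoothSectionAt (hσ : SmoothSectionOn n F σ U) (hU : U ∈ 𝓝 x) :
    SmoothSectionAt (n := n) F σ x :=
  ContMDiffOn.contMDiffAt hσ hU

theorem fiberCoord_injective (hx : x ∈ (trivializationAt F V p).baseSet) :
    Function.Injective (fiberCoord F V p x) :=
  Function.LeftInverse.injective (fiberFrame_fiberCoord hx)

theorem coordSection_hom_eventuallyEq (hx : x ∈ coordDomain (n := n) F V p) :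
    coordSection F p (fun y ↦ φ y (Y y)) =ᶠ[𝓝 (extChartAt (𝓡 n) p x)]
      fun z ↦ coordHom F p φ z (coordField p Y z) := by
  refine eventually_extChartAt_nhds (P := fun z y ↦ fiberCoord F V p y (φ y (Y y)) =
    coordHom F p φ z (coordField p Y z)) hx.1 ?_
  filter_upwards [eventually_mem_coordDomain hx] with y hy
  rw [coordField, coordSection_apply hy.1]
  exact (coordHom_apply hy (Y y)).symm

/-- The torsion relative to `φ` in coordinates. -/
theorem fiberCoord_torsion (hD : IsChristoffelSymbolAt p D Γ x)
    (hx : x ∈ coordDomain (n := n) F V p)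
    (hφ : SmoothSectionAt (n := n) (EuclideanSpace ℝ (Fin n) →L[ℝ] F) φ x)
    (hX : SmoothSectionAt (n := n) (EuclideanSpace ℝ (Fin n)) X x)
    (hY : SmoothSectionAt (n := n) (EuclideanSpace ℝ (Fin n)) Y x) :
    fiberCoord F V p x (D (fun y ↦ φ y (Y y)) x (X x) - D (fun y ↦ φ y (X y)) x (Y x)
      - φ x (VectorField.mlieBracket (𝓡 n) X Y x)) =
    fderiv ℝ (coordHom F p φ) (extChartAt (𝓡 n) p x) (tangentCoord p x (X x))
        (tangentCoord p x (Y x)) +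
      Γ (extChartAt (𝓡 n) p x) (tangentCoord p x (X x))
        (coordHom F p φ (extChartAt (𝓡 n) p x) (tangentCoord p x (Y x))) -
    (fderiv ℝ (coordHom F p φ) (extChartAt (𝓡 n) p x) (tangentCoord p x (Y x))
        (tangentCoord p x (X x)) +
      Γ (extChartAt (𝓡 n) p x) (tangentCoord p x (Y x))
        (coordHom F p φ (extChartAt (𝓡 n) p x) (tangentCoord p x (X x)))) := by
  have hφ' := (((contDiffAt_coordHom_iff hx).2 hφ).differentiableAt (by simp)).hasFDerivAt
  have key : ∀ Z : Π x : M, TangentSpace (𝓡 n) x,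
      SmoothSectionAt (n := n) (EuclideanSpace ℝ (Fin n)) Z x → ∀ W : Π x : M, TangentSpace (𝓡 n) x,
      fiberCoord F V p x (D (fun y ↦ φ y (Z y)) x (W x)) =
        fderiv ℝ (coordHom F p φ) (extChartAt (𝓡 n) p x) (tangentCoord p x (W x))
          (tangentCoord p x (Z x)) +
        coordHom F p φ (extChartAt (𝓡 n) p x)
          (fderiv ℝ (coordField p Z) (extChartAt (𝓡 n) p x) (tangentCoord p x (W x))) +
        Γ (extChartAt (𝓡 n) p x) (tangentCoord p x (W x))
          (coordHom F p φ (extChartAt (𝓡 n) p x) (tangentCoord p x (Z x))) := fun Z hZ W ↦ by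
    have hZ' := (((smoothSectionAt_iff_coordSection (p := p) ⟨hx.1, hx.1⟩).1 hZ).differentiableAt
      (by simp)).hasFDerivAt
    have he := coordSection_hom_eventuallyEq (φ := φ) (Y := Z) hx
    have hd := hφ'.clm_apply hZ'
    rw [hD _ ((mdifferentiableAt_section_iff_coordSection hx).2
      (hd.differentiableAt.congr_of_eventuallyEq he)), he.fderiv_eq, hd.fderiv, ← coordHom_apply hx,
      coordSection_apply (F := EuclideanSpace ℝ (Fin n)) hx.1]
    simp
    abel
  -- The derivatives of the component functions in `key` enter only through `φ` of the coordinate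
  -- bracket, which this term cancels.
  have hb := coordHom_apply hx (φ := φ) (VectorField.mlieBracket (𝓡 n) X Y x)
  rw [tangentCoord_mlieBracket hx.1 hX.mdifferentiableAt hY.mdifferentiableAt] at hb
  rw [map_sub, map_sub, key Y hY X, key X hX Y, ← hb, map_sub]
  abel

theorem RelativelyTorsionFreeOn.locallyTorsionFreeAt [T2Space M]
    (h : RelativelyTorsionFreeOn φ D U) (hxU : x ∈ U) (hD : IsChristoffelSymbolAt p D Γ x)
    (hx : x ∈ coordDomain (n := n) F V p)
    (hφ : SmoothSectionAt (n := n) (EuclideanSpace ℝ (Fin n) →L[ℝ] F) φ x) :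
    LocallyTorsionFreeAt Γ (coordHom F p φ) (extChartAt (𝓡 n) p x) := by
  intro v w
  obtain ⟨X, hX, hXx⟩ := exists_smoothVectorField_apply_eq (tangentFrame p x v)
  obtain ⟨Y, hY, hYx⟩ := exists_smoothVectorField_apply_eq (tangentFrame p x w)
  have ht := fiberCoord_torsion hD hx hφ (hX.smoothSectionAt x) (hY.smoothSectionAt x)
  rw [h X Y (ContMDiff.contMDiffOn hX) (ContMDiff.contMDiffOn hY) x hxU, map_zero, hXx, hYx] at ht
  have hv := fiberCoord_fiberFrame (F := EuclideanSpace ℝ (Fin n))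
    (V := (TangentSpace (𝓡 n) : M → Type _)) (p := p) (x := x) hx.1
  simp only [tangentCoord, tangentFrame, hv] at ht
  exact (sub_eq_zero.1 ht.symm)

theorem relativelyTorsionFreeOn_of_locallyTorsionFreeAt (hU : IsOpen U)
    (hUp : U ⊆ coordDomain (n := n) F V p) (hD : ∀ x ∈ U, IsChristoffelSymbolAt p D Γ x)
    (hφ : ∀ x ∈ U, SmoothSectionAt (n := n) (EuclideanSpace ℝ (Fin n) →L[ℝ] F) φ x)
    (htor : ∀ x ∈ U, LocallyTorsionFreeAt Γ (coordHom F p φ) (extChartAt (𝓡 n) p x)) :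
    RelativelyTorsionFreeOn φ D U := by
  intro X Y hX hY x hx
  apply fiberCoord_injective (hUp hx).2
  rw [map_zero, fiberCoord_torsion (hD x hx) (hUp hx) (hφ x hx)
    (SmoothSectionOn.smoothSectionAt hX (hU.mem_nhds hx))
    (SmoothSectionOn.smoothSectionAt hY (hU.mem_nhds hx)), htor x hx, sub_self]

/-- The trace is invariant under conjugation by the frame, and the conjugated coordinate curvature
is the endomorphism `η ↦ R(X, Y)η` to which the hypothesis applies. -/
theorem TraceFreeCurvature.trace_localCurvature [T2Space M] (h : TraceFreeCurvature F D)
    (hD : ∀ᶠ y in 𝓝 x, IsChristoffelSymbolAt p D Γ y)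
    (hΓ : ContDiffAt ℝ ∞ Γ (extChartAt (𝓡 n) p x)) (hx : x ∈ coordDomain (n := n) F V p)
    (v w : EuclideanSpace ℝ (Fin n)) :
    LinearMap.trace ℝ F (localCurvature Γ (extChartAt (𝓡 n) p x) v w) = 0 := by
  obtain ⟨X, hX, hXx⟩ := exists_smoothVectorField_apply_eq (tangentFrame p x v)
  obtain ⟨Y, hY, hYx⟩ := exists_smoothVectorField_apply_eq (tangentFrame p x w)
  have hv := fiberCoord_fiberFrame (F := EuclideanSpace ℝ (Fin n))
    (V := (TangentSpace (𝓡 n) : M → Type _)) (p := p) (x := x) hx.1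
  let e : F ≃ₗ[ℝ] V x := LinearEquiv.ofLinearMap (fiberFrame F V p x) (fiberCoord F V p x)
    (LinearMap.ext (fiberFrame_fiberCoord hx.2)) (LinearMap.ext (fiberCoord_fiberFrame hx.2))
  rw [← LinearMap.trace_conj' _ e]
  refine h X Y hX hY x _ fun σ hσ ↦ fiberCoord_injective hx.2 ?_
  rw [fiberCoord_curvature hD hΓ hx (hX.smoothSectionAt x) (hY.smoothSectionAt x)
    (hσ.smoothSectionAt x), hXx, hYx]
  simp only [tangentCoord, tangentFrame, hv]
  exact fiberCoord_fiberFrame hx.2 _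

/-- The curvature condition at the point `x`. -/
def CurvatureConditionAt (φ : Π x : M, TangentSpace (𝓡 n) x →L[ℝ] V x)
    (D : (Π x : M, V x) → Π x : M, TangentSpace (𝓡 n) x →L[ℝ] V x)
    (A : Π x : M, TangentSpace (𝓡 n) x →L[ℝ] V x →L[ℝ] ℝ) (x : M) : Prop :=
  ∀ X Y : Π x : M, TangentSpace (𝓡 n) x, SmoothVectorField X → SmoothVectorField Y →
    ∀ η : Π x : M, V x, SmoothSection n F η →
      curvature D X Y η x =
        (1 / ((n : ℝ) - 1)) • (A x (Y x) (η x) • φ x (X x) - A x (X x) (η x) • φ x (Y x))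

/-- The Codazzi condition at the point `x`. -/
def CodazziConditionAt (D : (Π x : M, V x) → Π x : M, TangentSpace (𝓡 n) x →L[ℝ] V x)
    (A : Π x : M, TangentSpace (𝓡 n) x →L[ℝ] V x →L[ℝ] ℝ) (x : M) : Prop :=
  ∀ X Y : Π x : M, TangentSpace (𝓡 n) x, SmoothVectorField X → SmoothVectorField Y →
    ∀ η : Π x : M, V x, SmoothSection n F η →
      mvfderiv (𝓡 n) (fun y ↦ A y (Y y) (η y)) x (X x)
        - mvfderiv (𝓡 n) (fun y ↦ A y (X y) (η y)) x (Y x)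
        - A x (VectorField.mlieBracket (𝓡 n) X Y x) (η x)
      = A x (Y x) (D η x (X x)) - A x (X x) (D η x (Y x))

/-- Both sides are tensorial, so testing on global fields through prescribed vectors at `x` loses
nothing. -/
theorem curvatureConditionAt_iff [T2Space M] (hD : ∀ᶠ y in 𝓝 x, IsChristoffelSymbolAt p D Γ y)
    (hΓ : ContDiffAt ℝ ∞ Γ (extChartAt (𝓡 n) p x)) (hx : x ∈ coordDomain (n := n) F V p) :
    CurvatureConditionAt (F := F) φ D A x ↔ ∀ v w f,
      localCurvature Γ (extChartAt (𝓡 n) p x) v w f = (1 / ((n : ℝ) - 1)) •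
        (coordForm F p A (extChartAt (𝓡 n) p x) w f • coordHom F p φ (extChartAt (𝓡 n) p x) v -
          coordForm F p A (extChartAt (𝓡 n) p x) v f •
            coordHom F p φ (extChartAt (𝓡 n) p x) w) := by
  have hv := fiberCoord_fiberFrame (F := EuclideanSpace ℝ (Fin n))
    (V := (TangentSpace (𝓡 n) : M → Type _)) (p := p) (x := x) hx.1
  constructor
  · intro h v w f
    obtain ⟨X, hX, hXx⟩ := exists_smoothVectorField_apply_eq (tangentFrame p x v)
    obtain ⟨Y, hY, hYx⟩ := exists_smoothVectorField_apply_eq (tangentFrame p x w)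
    obtain ⟨η, hη, hηx⟩ := exists_smoothSection_apply_eq (n := n) (F := F) (fiberFrame F V p x f)
    have hc := congrArg (fiberCoord F V p x) (h X Y hX hY η hη)
    rw [fiberCoord_curvature hD hΓ hx (hX.smoothSectionAt x) (hY.smoothSectionAt x)
      (hη.smoothSectionAt x)] at hc
    simp only [map_smul, map_sub, ← coordForm_apply hx, ← coordHom_apply hx, hXx, hYx, hηx,
      fiberCoord_fiberFrame hx.2] at hc
    simpa only [tangentCoord, tangentFrame, hv] using hc
  · intro h X Y hX hY η hη
    apply fiberCoord_injective hx.2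
    rw [fiberCoord_curvature hD hΓ hx (hX.smoothSectionAt x) (hY.smoothSectionAt x)
      (hη.smoothSectionAt x), h]
    simp only [map_smul, map_sub, ← coordForm_apply hx, ← coordHom_apply hx]

/-- The Codazzi tensor in coordinates. -/
theorem codazzi_apply (hD : IsChristoffelSymbolAt p D Γ x)
    (hx : x ∈ coordDomain (n := n) F V p)
    (hA : SmoothSectionAt (n := n) (EuclideanSpace ℝ (Fin n) →L[ℝ] F →L[ℝ] ℝ) A x)
    (hX : SmoothSectionAt (n := n) (EuclideanSpace ℝ (Fin n)) X x)
    (hY : SmoothSectionAt (n := n) (EuclideanSpace ℝ (Fin n)) Y x)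
    (hσ : SmoothSectionAt (n := n) F σ x) :
    mvfderiv (𝓡 n) (fun y ↦ A y (Y y) (σ y)) x (X x)
        - mvfderiv (𝓡 n) (fun y ↦ A y (X y) (σ y)) x (Y x)
        - A x (VectorField.mlieBracket (𝓡 n) X Y x) (σ x)
        - (A x (Y x) (D σ x (X x)) - A x (X x) (D σ x (Y x))) =
      fderiv ℝ (coordForm F p A) (extChartAt (𝓡 n) p x) (tangentCoord p x (X x))
        (tangentCoord p x (Y x)) (fiberCoord F V p x (σ x)) -
      fderiv ℝ (coordForm F p A) (extChartAt (𝓡 n) p x) (tangentCoord p x (Y x))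
        (tangentCoord p x (X x)) (fiberCoord F V p x (σ x)) -
      (coordForm F p A (extChartAt (𝓡 n) p x) (tangentCoord p x (Y x))
        (Γ (extChartAt (𝓡 n) p x) (tangentCoord p x (X x)) (fiberCoord F V p x (σ x))) -
      coordForm F p A (extChartAt (𝓡 n) p x) (tangentCoord p x (X x))
        (Γ (extChartAt (𝓡 n) p x) (tangentCoord p x (Y x)) (fiberCoord F V p x (σ x)))) := by
  have hA' := (((contDiffAt_coordForm_iff hx).2 hA).differentiableAt (by simp)).hasFDerivAt
  have hσ' := (((smoothSectionAt_iff_coordSection hx).1 hσ).differentiableAt (by simp)).hasFDerivAt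
  have key : ∀ Z : Π x : M, TangentSpace (𝓡 n) x,
      SmoothSectionAt (n := n) (EuclideanSpace ℝ (Fin n)) Z x → ∀ v : TangentSpace (𝓡 n) x,
      mvfderiv (𝓡 n) (fun y ↦ A y (Z y) (σ y)) x v =
        fderiv ℝ (coordForm F p A) (extChartAt (𝓡 n) p x) (tangentCoord p x v)
          (tangentCoord p x (Z x)) (fiberCoord F V p x (σ x)) +
        coordForm F p A (extChartAt (𝓡 n) p x) (fderiv ℝ (coordField p Z) (extChartAt (𝓡 n) p x)
          (tangentCoord p x v)) (fiberCoord F V p x (σ x)) +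
        coordForm F p A (extChartAt (𝓡 n) p x) (tangentCoord p x (Z x))
          (fderiv ℝ (coordSection F p σ) (extChartAt (𝓡 n) p x) (tangentCoord p x v)) :=
      fun Z hZ v ↦ by
    have hZ' := (((smoothSectionAt_iff_coordSection (p := p) ⟨hx.1, hx.1⟩).1 hZ).differentiableAt
      (by simp)).hasFDerivAt
    have he : (fun y ↦ A y (Z y) (σ y)) ∘ (extChartAt (𝓡 n) p).symm =ᶠ[𝓝 (extChartAt (𝓡 n) p x)]
        fun z ↦ coordForm F p A z (coordField p Z z) (coordSection F p σ z) := by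
      refine eventually_extChartAt_nhds (P := fun z y ↦ A y (Z y) (σ y) =
        coordForm F p A z (coordField p Z z) (coordSection F p σ z)) hx.1 ?_
      filter_upwards [eventually_mem_coordDomain hx] with y hy
      rw [coordField, coordSection_apply hy.1, coordSection_apply hy.1]
      exact (coordForm_apply hy (Z y) (σ y)).symm
    have hd := (hA'.clm_apply hZ').clm_apply hσ'
    rw [mvfderiv_eq_fderiv_chart hx.1 ((mdifferentiableAt_iff_differentiableAt_chart hx.1).2
      (hd.differentiableAt.congr_of_eventuallyEq he)), he.fderiv_eq, hd.fderiv,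
      coordSection_apply (F := EuclideanSpace ℝ (Fin n)) hx.1, coordSection_apply hx.1]
    simp
    ring
  rw [key Y hY, key X hX]
  simp only [← coordForm_apply hx, hD σ hσ.mdifferentiableAt,
    tangentCoord_mlieBracket hx.1 hX.mdifferentiableAt hY.mdifferentiableAt, map_sub, map_add,
    sub_apply]
  ring

theorem codazziConditionAt_iff [T2Space M] (hD : IsChristoffelSymbolAt p D Γ x)
    (hx : x ∈ coordDomain (n := n) F V p)
    (hA : SmoothSectionAt (n := n) (EuclideanSpace ℝ (Fin n) →L[ℝ] F →L[ℝ] ℝ) A x) :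
    CodazziConditionAt (F := F) D A x ↔ ∀ v w f,
      fderiv ℝ (coordForm F p A) (extChartAt (𝓡 n) p x) v w f -
      fderiv ℝ (coordForm F p A) (extChartAt (𝓡 n) p x) w v f =
      coordForm F p A (extChartAt (𝓡 n) p x) w (Γ (extChartAt (𝓡 n) p x) v f) -
      coordForm F p A (extChartAt (𝓡 n) p x) v (Γ (extChartAt (𝓡 n) p x) w f) := by
  have hv := fiberCoord_fiberFrame (F := EuclideanSpace ℝ (Fin n))
    (V := (TangentSpace (𝓡 n) : M → Type _)) (p := p) (x := x) hx.1
  constructor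
  · intro h v w f
    obtain ⟨X, hX, hXx⟩ := exists_smoothVectorField_apply_eq (tangentFrame p x v)
    obtain ⟨Y, hY, hYx⟩ := exists_smoothVectorField_apply_eq (tangentFrame p x w)
    obtain ⟨η, hη, hηx⟩ := exists_smoothSection_apply_eq (n := n) (F := F) (fiberFrame F V p x f)
    have hc := codazzi_apply hD hx hA (hX.smoothSectionAt x) (hY.smoothSectionAt x)
      (hη.smoothSectionAt x)
    rw [h X Y hX hY η hη, sub_self, hXx, hYx, hηx, fiberCoord_fiberFrame hx.2] at hc
    simp only [tangentCoord, tangentFrame, hv] at hc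
    exact sub_eq_zero.1 hc.symm
  · intro h X Y hX hY η hη
    refine sub_eq_zero.1 ?_
    rw [codazzi_apply hD hx hA (hX.smoothSectionAt x) (hY.smoothSectionAt x)
      (hη.smoothSectionAt x), h, sub_self]

end PointwiseConditions

/-! ### Uniqueness of the tensor and gluing -/

section ProjectiveFlatness

open Filter Topology

set_option linter.unusedSectionVars false

/-- An interior point of the null set would give a nonempty open set in a chart image, which has
positive volume. -/
theorem ManifoldNull.dense_compl {n : ℕ} {M : Type*} [TopologicalSpace M]
    [ChartedSpace (EuclideanSpace ℝ (Fin n)) M] {S : Set M} (hS : ManifoldNull (n := n) S) :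
    Dense Sᶜ := by
  rw [← interior_eq_empty_iff_dense_compl, eq_empty_iff_forall_notMem]
  intro x hx
  let e := chartAt (EuclideanSpace ℝ (Fin n)) x
  have ho : IsOpen (e '' (e.source ∩ interior S)) :=
    e.isOpen_image_source_inter isOpen_interior
  refine (ho.measure_pos volume ⟨e x, x, ⟨mem_chart_source _ x, hx⟩, rfl⟩).ne' ?_
  exact measure_mono_null (image_mono (inter_subset_inter_right _ interior_subset))
    (hS e (chart_mem_atlas _ x))

variable {n : ℕ} {M : Type*} [TopologicalSpace M] [ChartedSpace (EuclideanSpace ℝ (Fin n)) M]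
  [IsManifold (𝓡 n) ∞ M]
  {F : Type*} [NormedAddCommGroup F] [NormedSpace ℝ F] [FiniteDimensional ℝ F]
  {V : M → Type*} [TopologicalSpace (TotalSpace F V)]
  [∀ x, AddCommGroup (V x)] [∀ x, Module ℝ (V x)] [∀ x, TopologicalSpace (V x)]
  [∀ x, IsTopologicalAddGroup (V x)] [∀ x, ContinuousSMul ℝ (V x)]
  [FiberBundle F V] [VectorBundle ℝ F V] [ContMDiffVectorBundle ∞ F V (𝓡 n)]
  {p x : M} {σ : Π x : M, V x} {X Y : Π x : M, TangentSpace (𝓡 n) x}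
  {φ : Π x : M, TangentSpace (𝓡 n) x →L[ℝ] V x}
  {A A' : Π x : M, TangentSpace (𝓡 n) x →L[ℝ] V x →L[ℝ] ℝ} {ρ : Π x : M, V x →L[ℝ] ℝ}
  {D D' : (Π x : M, V x) → Π x : M, TangentSpace (𝓡 n) x →L[ℝ] V x} {U : Set M}
  {Γ : EuclideanSpace ℝ (Fin n) → EuclideanSpace ℝ (Fin n) →L[ℝ] F →L[ℝ] F}

theorem finrank_range_le_dim (x : M) (L : TangentSpace (𝓡 n) x →ₗ[ℝ] V x) :
    Module.finrank ℝ (LinearMap.range L) ≤ n := by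
  have : Module.Finite ℝ (TangentSpace (𝓡 n) x) :=
    inferInstanceAs (Module.Finite ℝ (EuclideanSpace ℝ (Fin n)))
  exact (LinearMap.finrank_range_le L).trans_eq
    (finrank_euclideanSpace_fin : Module.finrank ℝ (EuclideanSpace ℝ (Fin n)) = n)

/-- At a point where `φ` has rank at least two, the tensor in the curvature condition is unique. -/
theorem CurvatureConditionAt.unique [T2Space M] (h : CurvatureConditionAt (F := F) φ D A x)
    (h' : CurvatureConditionAt (F := F) φ D A' x)
    (hr : 2 ≤ Module.finrank ℝ (LinearMap.range (φ x).toLinearMap)) : A x = A' x := by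
  have hn : (1 / ((n : ℝ) - 1)) ≠ 0 := by
    have h2 : (2 : ℝ) ≤ n := by exact_mod_cast hr.trans (finrank_range_le_dim x _)
    exact one_div_ne_zero (by linarith)
  -- Difference of the two curvature conditions. If the coefficient on the right is nonzero for some
  -- `v` and `u`, every `φ x w` is a multiple of `φ x v`, which forces rank at most one.
  have key : ∀ (v w : TangentSpace (𝓡 n) x) (u : V x),
      (A x w u - A' x w u) • φ x v = (A x v u - A' x v u) • φ x w := fun v w u ↦ by
    obtain ⟨X, hX, rfl⟩ := exists_smoothVectorField_apply_eq v
    obtain ⟨Y, hY, rfl⟩ := exists_smoothVectorField_apply_eq w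
    obtain ⟨η, hη, rfl⟩ := exists_smoothSection_apply_eq (n := n) (F := F) u
    have hh := smul_right_injective _ hn ((h X Y hX hY η hη).symm.trans (h' X Y hX hY η hη))
    simp only [sub_smul]
    rw [sub_eq_sub_iff_sub_eq_sub]
    exact hh
  by_contra hne
  obtain ⟨v, u, hvu⟩ : ∃ v u, A x v u - A' x v u ≠ 0 := by
    by_contra! hall
    exact hne (ContinuousLinearMap.ext fun v ↦ ContinuousLinearMap.ext fun u ↦
      sub_eq_zero.1 (hall v u))
  have : Module.finrank ℝ (LinearMap.range (φ x).toLinearMap) ≤ 1 := by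
    refine finrank_le_one ⟨φ x v, v, rfl⟩ ?_
    rintro ⟨_, w, rfl⟩
    refine ⟨(A x v u - A' x v u)⁻¹ * (A x w u - A' x w u), Subtype.ext ?_⟩
    change ((A x v u - A' x v u)⁻¹ * (A x w u - A' x w u)) • φ x v = φ x w
    rw [mul_smul, key v w u, inv_smul_smul₀ hvu]
  omega

theorem RankGEAlmostEverywhere.frequently {k : ℕ} (h : RankGEAlmostEverywhere φ k) (x : M) :
    ∃ᶠ y in 𝓝 x, k ≤ Module.finrank ℝ (LinearMap.range (φ y).toLinearMap) := by
  have := mem_closure_iff_frequently.1 ((ManifoldNull.dense_compl h) x)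
  simpa using this

theorem RankGEAlmostEverywhere.le_dim {k : ℕ} (h : RankGEAlmostEverywhere φ k) (x : M) :
    k ≤ n := by
  obtain ⟨y, hy⟩ := (h.frequently x).exists
  exact hy.trans (finrank_range_le_dim y _)

/-- If `φ` has rank at least two almost everywhere, a smooth tensor in the curvature condition is
unique. -/
theorem CurvatureConditionAt.unique_of_rankGEAlmostEverywhere [T2Space M]
    (hr : RankGEAlmostEverywhere φ 2)
    (h : ∀ᶠ y in 𝓝 x, CurvatureConditionAt (F := F) φ D A y)
    (h' : ∀ᶠ y in 𝓝 x, CurvatureConditionAt (F := F) φ D A' y)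
    (hA : SmoothSectionAt (n := n) (EuclideanSpace ℝ (Fin n) →L[ℝ] F →L[ℝ] ℝ) A x)
    (hA' : SmoothSectionAt (n := n) (EuclideanSpace ℝ (Fin n) →L[ℝ] F →L[ℝ] ℝ) A' x) :
    A x = A' x := by
  have hx := mem_coordDomain_self (n := n) F V x
  have hc := continuousAt_extChartAt_apply hx.1
  have ht := ((contDiffAt_coordForm_iff hx).2 hA).continuousAt.tendsto.comp hc
  have ht' := ((contDiffAt_coordForm_iff hx).2 hA').continuousAt.tendsto.comp hc
  -- The two continuous coordinate expressions agree at points of rank at least two arbitrarily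
  -- close to `x`, so their values at `x` agree.
  have heq := tendsto_nhds_unique_of_frequently_eq ht ht'
    (((hr.frequently x).and_eventually (h.and (h'.and (eventually_mem_coordDomain hx)))).mono
      fun y hy ↦ by
        have hyA := hy.2.1.unique hy.2.2.1 hy.1
        rw [Function.comp_apply, Function.comp_apply, coordForm, coordForm,
          extChartAt_symm_apply_self hy.2.2.2.1, hyA])
  ext v u
  rw [← coordForm_apply hx, ← coordForm_apply hx, heq]

/-- The condition involves first derivatives of the tensor, so it depends on the germ; equality at
`x` alone would not be enough. -/
theorem CodazziConditionAt.congr (h : CodazziConditionAt (F := F) D A x)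
    (hA : ∀ᶠ y in 𝓝 x, A' y = A y) : CodazziConditionAt (F := F) D A' x := by
  intro X Y hX hY η hη
  have key : ∀ Z : Π x : M, TangentSpace (𝓡 n) x, mvfderiv (𝓡 n) (fun y ↦ A' y (Z y) (η y)) x =
      mvfderiv (𝓡 n) (fun y ↦ A y (Z y) (η y)) x := fun Z ↦ by
    have he : (fun y ↦ A' y (Z y) (η y)) =ᶠ[𝓝 x] fun y ↦ A y (Z y) (η y) :=
      hA.mono fun y hy ↦ congrArg (fun T ↦ T (Z y) (η y)) hy
    rw [mvfderiv, mvfderiv, he.mfderiv_eq, hA.self_of_nhds]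
  rw [key, key, hA.self_of_nhds]
  exact h X Y hX hY η hη

/-- Local solutions of the two conditions on the tensor `A` glue to a global one. -/
theorem exists_global_tensor [T2Space M] (hr : RankGEAlmostEverywhere φ 2)
    (h : ∀ p : M, ∃ A : Π x : M, TangentSpace (𝓡 n) x →L[ℝ] V x →L[ℝ] ℝ, ∀ᶠ x in 𝓝 p,
      SmoothSectionAt (n := n) (EuclideanSpace ℝ (Fin n) →L[ℝ] F →L[ℝ] ℝ) A x ∧
      CurvatureConditionAt (F := F) φ D A x ∧ CodazziConditionAt (F := F) D A x) :
    ∃ A : Π x : M, TangentSpace (𝓡 n) x →L[ℝ] V x →L[ℝ] ℝ,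
      SmoothSection n (EuclideanSpace ℝ (Fin n) →L[ℝ] F →L[ℝ] ℝ) A ∧
      CurvatureCondition F φ D A ∧ CodazziCondition F D A := by
  choose A hA using h
  -- The glued tensor takes at `x` the value of the solution chosen for `x`. By uniqueness it
  -- coincides near `p` with the solution chosen for `p`, and so inherits its smoothness and its
  -- equations.
  have key : ∀ p, ∀ᶠ x in 𝓝 p, A x x = A p x := fun p ↦ by
    filter_upwards [(hA p).eventually_nhds] with x hx
    exact CurvatureConditionAt.unique_of_rankGEAlmostEverywhere hr ((hA x).mono fun y hy ↦ hy.2.1)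
      (hx.mono fun y hy ↦ hy.2.1) (hA x).self_of_nhds.1 hx.self_of_nhds.1
  refine ⟨fun x ↦ A x x, fun p ↦ ?_, fun X Y hX hY η hη p ↦ ?_, fun X Y hX hY η hη p ↦ ?_⟩
  · exact ContMDiffAt.congr_of_eventuallyEq (hA p).self_of_nhds.1
      ((key p).mono fun x hx ↦ congrArg (TotalSpace.mk x) hx)
  · exact (hA p).self_of_nhds.2.1 X Y hX hY η hη
  · exact ((hA p).self_of_nhds.2.2.congr (key p)) X Y hX hY η hη

/-- The section of `T*M ⊗ V*` with coordinate expression `B`. -/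
def formOfCoord (p : M)
    (B : EuclideanSpace ℝ (Fin n) → EuclideanSpace ℝ (Fin n) →L[ℝ] F →L[ℝ] ℝ) (x : M) :
    TangentSpace (𝓡 n) x →L[ℝ] V x →L[ℝ] ℝ :=
  (ContinuousLinearMap.precomp ℝ (fiberCoord F V p x)).comp
    ((B (extChartAt (𝓡 n) p x)).comp (tangentCoord p x))

/-- The section of `V*` with coordinate expression `u`. -/
def covectorOfCoord (p : M) (u : EuclideanSpace ℝ (Fin n) → F →L[ℝ] ℝ) (x : M) : V x →L[ℝ] ℝ :=
  (u (extChartAt (𝓡 n) p x)).comp (fiberCoord F V p x)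

theorem coordForm_formOfCoord_eventuallyEq (hx : x ∈ coordDomain (n := n) F V p)
    (B : EuclideanSpace ℝ (Fin n) → EuclideanSpace ℝ (Fin n) →L[ℝ] F →L[ℝ] ℝ) :
    coordForm F p (formOfCoord (V := V) p B) =ᶠ[𝓝 (extChartAt (𝓡 n) p x)] B := by
  filter_upwards [eventually_extChartAt_right_inv hx.1,
    continuousAt_extChartAt_symm_apply hx.1 (eventually_mem_coordDomain hx)] with z hz hz'
  have hv := fiberCoord_fiberFrame (F := EuclideanSpace ℝ (Fin n))
    (V := (TangentSpace (𝓡 n) : M → Type _)) (p := p) hz'.1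
  ext h f
  change B (extChartAt (𝓡 n) p ((extChartAt (𝓡 n) p).symm z))
    (tangentCoord p _ (tangentFrame p _ h)) (fiberCoord F V p _ (fiberFrame F V p _ f)) = B z h f
  rw [hz, fiberCoord_fiberFrame hz'.2]
  exact congrArg (fun k ↦ B z k f) (hv h)

theorem coordCovector_covectorOfCoord_eventuallyEq (hx : x ∈ coordDomain (n := n) F V p)
    (u : EuclideanSpace ℝ (Fin n) → F →L[ℝ] ℝ) :
    coordCovector F p (covectorOfCoord (V := V) p u) =ᶠ[𝓝 (extChartAt (𝓡 n) p x)] u := by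
  filter_upwards [eventually_extChartAt_right_inv hx.1,
    continuousAt_extChartAt_symm_apply hx.1 (eventually_mem_coordDomain hx)] with z hz hz'
  ext f
  change u (extChartAt (𝓡 n) p ((extChartAt (𝓡 n) p).symm z))
    (fiberCoord F V p _ (fiberFrame F V p _ f)) = u z f
  rw [hz, fiberCoord_fiberFrame hz'.2]

end ProjectiveFlatness

/-! ### The two implications -/

section Equivalence

open Filter Topology

set_option linter.unusedSectionVars false
set_option synthInstance.maxHeartbeats 200000
set_option maxHeartbeats 1000000

variable {n : ℕ} {M : Type*} [TopologicalSpace M] [ChartedSpace (EuclideanSpace ℝ (Fin n)) M]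
  [IsManifold (𝓡 n) ∞ M]
  {F : Type*} [NormedAddCommGroup F] [NormedSpace ℝ F] [FiniteDimensional ℝ F]
  {V : M → Type*} [TopologicalSpace (TotalSpace F V)]
  [∀ x, AddCommGroup (V x)] [∀ x, Module ℝ (V x)] [∀ x, TopologicalSpace (V x)]
  [∀ x, IsTopologicalAddGroup (V x)] [∀ x, ContinuousSMul ℝ (V x)]
  [FiberBundle F V] [VectorBundle ℝ F V] [ContMDiffVectorBundle ∞ F V (𝓡 n)]
  {p x : M} {σ : Π x : M, V x} {X Y : Π x : M, TangentSpace (𝓡 n) x}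
  {φ : Π x : M, TangentSpace (𝓡 n) x →L[ℝ] V x}
  {A A' : Π x : M, TangentSpace (𝓡 n) x →L[ℝ] V x →L[ℝ] ℝ} {ρ : Π x : M, V x →L[ℝ] ℝ}
  {D D' : (Π x : M, V x) → Π x : M, TangentSpace (𝓡 n) x →L[ℝ] V x} {U : Set M}
  {Γ Γ' : EuclideanSpace ℝ (Fin n) → EuclideanSpace ℝ (Fin n) →L[ℝ] F →L[ℝ] F}

/-- If the projective change of a trace-free connection by `ρ` is flat, the tensor
`∇ρ - (ρ ∘ φ) ⊗ ρ` is symmetric and determines the curvature. -/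
theorem projectiveTensor_symm_of_flat {E : Type*} [NormedAddCommGroup E] [NormedSpace ℝ E]
    [FiniteDimensional ℝ E] {Γ : E → E →L[ℝ] F →L[ℝ] F} {φ : E → E →L[ℝ] F} {ρ : E → F →L[ℝ] ℝ}
    {z : E} (hΓ : ContDiffAt ℝ 1 Γ z) (hφ : ContDiffAt ℝ 1 φ z) (hρ : ContDiffAt ℝ 1 ρ z)
    (htor : LocallyTorsionFreeAt Γ φ z)
    (htr : ∀ h k, LinearMap.trace ℝ F (localCurvature Γ z h k) = 0)
    (hflat : ∀ h k f, localCurvature (projectiveChange Γ φ ρ) z h k f = 0) :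
    (∀ h k, projectiveTensor Γ φ ρ z h (φ z k) = projectiveTensor Γ φ ρ z k (φ z h)) ∧
    ∀ h k f, localCurvature Γ z h k f =
      projectiveTensor Γ φ ρ z k f • φ z h - projectiveTensor Γ φ ρ z h f • φ z k := by
  have key : ∀ h k f, localCurvature Γ z h k f =
      (projectiveTensor Γ φ ρ z k (φ z h) - projectiveTensor Γ φ ρ z h (φ z k)) • f +
      projectiveTensor Γ φ ρ z k f • φ z h - projectiveTensor Γ φ ρ z h f • φ z k := by
    intro h k f
    have := localCurvature_projectiveChange hΓ hφ hρ htor h k f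
    rw [hflat] at this
    rw [← sub_eq_zero, this]
    module
  have hsymm : ∀ h k, projectiveTensor Γ φ ρ z h (φ z k) =
      projectiveTensor Γ φ ρ z k (φ z h) := fun h k ↦ by
    have := trace_eq_of_apply_eq (L := localCurvature Γ z h k)
      (b₁ := projectiveTensor Γ φ ρ z k) (b₂ := projectiveTensor Γ φ ρ z h) (key h k)
    rw [htr] at this
    have hpos : (0 : ℝ) < Module.finrank ℝ F + 1 := by positivity
    -- The identity term contributes the rank and the two rank-one terms contribute one more, so the
    -- antisymmetric part is multiplied by rank + 1, which is nonzero.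
    have h0 : (projectiveTensor Γ φ ρ z k (φ z h) - projectiveTensor Γ φ ρ z h (φ z k)) *
      (Module.finrank ℝ F + 1) = 0 := by linarith
    linarith [(mul_eq_zero.1 h0).resolve_right hpos.ne']
  refine ⟨hsymm, fun h k f ↦ ?_⟩
  rw [key h k f, hsymm h k, sub_self, zero_smul, zero_add]

/-- The Christoffel symbols of a projectively equivalent connection. -/
theorem IsChristoffelSymbolAt.of_projective_change
    (hD : IsChristoffelSymbolAt p D Γ x) (hx : x ∈ coordDomain (n := n) F V p)
    (h : ∀ σ : Π x : M, V x,
      MDifferentiableAt (𝓡 n) ((𝓡 n).prod 𝓘(ℝ, F)) (fun y ↦ TotalSpace.mk' F y (σ y)) x →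
      ∀ v, D' σ x v = D σ x v + ρ x (φ x v) • σ x + ρ x (σ x) • φ x v) :
    IsChristoffelSymbolAt p D' (projectiveChange Γ (coordHom F p φ) (coordCovector F p ρ)) x := by
  intro σ hσ v
  rw [h σ hσ v, map_add, map_add, map_smul, map_smul, hD σ hσ v, projectiveChange_apply,
    coordHom_apply hx, coordCovector_apply hx, coordCovector_apply hx]
  abel

theorem ProjectivelyEquivalentOn.christoffel_eq [T2Space M]
    (hD : IsChristoffelSymbolAt p D Γ x) (hD' : IsChristoffelSymbolAt p D' Γ' x)
    (hx : x ∈ coordDomain (n := n) F V p) (hxU : x ∈ U)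
    (h : ∀ X : Π x : M, TangentSpace (𝓡 n) x, SmoothVectorFieldOn X U →
        ∀ σ : Π x : M, V x, SmoothSectionOn n F σ U → ∀ x ∈ U,
          D' σ x (X x) = D σ x (X x) + ρ x (φ x (X x)) • σ x + ρ x (σ x) • φ x (X x)) :
    Γ' (extChartAt (𝓡 n) p x) =
      projectiveChange Γ (coordHom F p φ) (coordCovector F p ρ) (extChartAt (𝓡 n) p x) := by
  ext v f
  obtain ⟨X, hX, hXx⟩ := exists_smoothVectorField_apply_eq (tangentFrame p x v)
  obtain ⟨σ, hσ, hσx⟩ := exists_smoothSection_apply_eq (n := n) (F := F) (fiberFrame F V p x f)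
  have hm := (hσ.smoothSectionAt x).mdifferentiableAt
  have hv := fiberCoord_fiberFrame (F := EuclideanSpace ℝ (Fin n))
    (V := (TangentSpace (𝓡 n) : M → Type _)) (p := p) (x := x) hx.1
  have he := congrArg (fiberCoord F V p x)
    (h X (ContMDiff.contMDiffOn hX) σ (ContMDiff.contMDiffOn hσ) x hxU)
  rw [map_add, map_add, map_smul, map_smul, hD σ hm, hD' σ hm, ← coordHom_apply hx,
    ← coordCovector_apply hx, ← coordCovector_apply hx, ← coordHom_apply hx, hXx, hσx,
    fiberCoord_fiberFrame hx.2] at he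
  simp only [tangentCoord, tangentFrame, hv] at he
  rw [add_assoc, add_assoc] at he
  rw [add_left_cancel he, projectiveChange_apply, add_assoc]

theorem localCurvature_congr {E : Type*} [NormedAddCommGroup E] [NormedSpace ℝ E]
    {Γ Γ' : E → E →L[ℝ] F →L[ℝ] F} {z : E} (h : Γ =ᶠ[𝓝 z] Γ') :
    localCurvature Γ z = localCurvature Γ' z := by
  ext v w f
  simp [h.fderiv_eq, h.self_of_nhds]

/-- The tensor of a projectively flat connection exists locally. -/
theorem ProjectivelyFlat.exists_local_tensor [T2Space M]
    (hn : 2 ≤ n)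
    (hφ : SmoothSection n (EuclideanSpace ℝ (Fin n) →L[ℝ] F) φ)
    (hD : IsSmoothConnectionOn F D univ) (htor : RelativelyTorsionFreeOn φ D univ)
    (htr : TraceFreeCurvature F D) (h : ProjectivelyFlat F φ D) (p : M) :
    ∃ A : Π x : M, TangentSpace (𝓡 n) x →L[ℝ] V x →L[ℝ] ℝ, ∀ᶠ x in 𝓝 p,
      SmoothSectionAt (n := n) (EuclideanSpace ℝ (Fin n) →L[ℝ] F →L[ℝ] ℝ) A x ∧
      CurvatureConditionAt (F := F) φ D A x ∧ CodazziConditionAt (F := F) D A x := by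
  obtain ⟨U, hU, hpU, D', hD', hflat, -, -, ρ, hρ, heq⟩ := h p
  obtain ⟨Γ, hΓ⟩ := hD.exists_isChristoffelSymbolAt isOpen_univ p
  obtain ⟨Γ', hΓ'⟩ := hD'.exists_isChristoffelSymbolAt hU p
  simp only [univ_inter] at hΓ
  have hN : IsOpen (U ∩ coordDomain (n := n) F V p) := hU.inter (isOpen_coordDomain F V p)
  let φ' := coordHom F p φ
  let ρ' := coordCovector (n := n) F p ρ
  have hn' : (n : ℝ) - 1 ≠ 0 := by
    have : (2 : ℝ) ≤ n := by exact_mod_cast hn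
    linarith
  -- The factor `n - 1` cancels the normalisation in the curvature condition; the Codazzi equation
  -- is linear and unaffected.
  refine ⟨formOfCoord p (fun z ↦ ((n : ℝ) - 1) • projectiveTensor Γ φ' ρ' z), ?_⟩
  filter_upwards [hN.mem_nhds ⟨hpU, mem_coordDomain_self F V p⟩] with x hx
  have hφx := (contDiffAt_coordHom_iff hx.2).2 (hφ.smoothSectionAt x)
  have hρx := (contDiffAt_coordCovector_iff hx.2).2 (hρ.smoothSectionAt (hU.mem_nhds hx.1))
  have hΓx := (hΓ x hx.2).2
  have hB := hΓx.projectiveTensor hφx hρx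
  have htorx := htor.locallyTorsionFreeAt (mem_univ x) (hΓ x hx.2).1 hx.2 (hφ.smoothSectionAt x)
  have hev : ∀ᶠ y in 𝓝 x, IsChristoffelSymbolAt p D Γ y :=
    (eventually_mem_coordDomain hx.2).mono fun y hy ↦ (hΓ y hy).1
  have hev' : ∀ᶠ y in 𝓝 x, IsChristoffelSymbolAt p D' Γ' y := by
    filter_upwards [hN.mem_nhds hx] with y hy using (hΓ' y hy).1
  -- Equality of germs, since the curvature of `Γ'` involves its first derivative.
  have hΓeq : Γ' =ᶠ[𝓝 (extChartAt (𝓡 n) p x)] projectiveChange Γ φ' ρ' := by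
    refine eventually_extChartAt_nhds (P := fun z _ ↦ Γ' z = projectiveChange Γ φ' ρ' z) hx.2.1 ?_
    filter_upwards [hN.mem_nhds hx] with y hy
    exact ProjectivelyEquivalentOn.christoffel_eq (hΓ y hy.2).1 (hΓ' y hy).1 hy.2 hy.1 heq
  have hflatx : ∀ v w f, localCurvature (projectiveChange Γ φ' ρ') (extChartAt (𝓡 n) p x) v w f =
      0 := fun v w f ↦ by
    obtain ⟨X, hX, hXx⟩ := exists_smoothVectorField_apply_eq (tangentFrame p x v)
    obtain ⟨Y, hY, hYx⟩ := exists_smoothVectorField_apply_eq (tangentFrame p x w)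
    obtain ⟨σ, hσ, hσx⟩ := exists_smoothSection_apply_eq (n := n) (F := F) (fiberFrame F V p x f)
    have hv := fiberCoord_fiberFrame (F := EuclideanSpace ℝ (Fin n))
      (V := (TangentSpace (𝓡 n) : M → Type _)) (p := p) (x := x) hx.2.1
    have hc := fiberCoord_curvature hev' (hΓ' x hx).2 hx.2 (hX.smoothSectionAt x)
      (hY.smoothSectionAt x) (hσ.smoothSectionAt x)
    rw [hflat X Y (ContMDiff.contMDiffOn hX) (ContMDiff.contMDiffOn hY) σ
      (ContMDiff.contMDiffOn hσ) x hx.1, map_zero, hXx, hYx, hσx, fiberCoord_fiberFrame hx.2.2,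
      localCurvature_congr hΓeq] at hc
    simp only [tangentCoord, tangentFrame, hv] at hc
    exact hc.symm
  obtain ⟨hsymm, hcurv⟩ := projectiveTensor_symm_of_flat (hΓx.of_le (by simp)) (hφx.of_le (by simp))
    (hρx.of_le (by simp)) htorx (htr.trace_localCurvature hev hΓx hx.2) hflatx
  have hA := coordForm_formOfCoord_eventuallyEq hx.2
    (fun z ↦ ((n : ℝ) - 1) • projectiveTensor Γ φ' ρ' z)
  have hAs : SmoothSectionAt (n := n) (EuclideanSpace ℝ (Fin n) →L[ℝ] F →L[ℝ] ℝ)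
      (formOfCoord p (fun z ↦ ((n : ℝ) - 1) • projectiveTensor Γ φ' ρ' z)) x :=
    (contDiffAt_coordForm_iff hx.2).1 ((hB.const_smul _).congr_of_eventuallyEq hA)
  refine ⟨hAs, (curvatureConditionAt_iff hev hΓx hx.2).2 fun v w f ↦ ?_,
    (codazziConditionAt_iff (hΓ x hx.2).1 hx.2 hAs).2 fun v w f ↦ ?_⟩
  · rw [hcurv, hA.self_of_nhds]
    simp only [smul_apply, smul_eq_mul, mul_smul, ← smul_sub]
    rw [smul_smul, one_div_mul_cancel hn', one_smul]
  · rw [hA.fderiv_eq, hA.self_of_nhds, fderiv_fun_const_smul (hB.differentiableAt (by simp))]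
    simp only [smul_apply, smul_eq_mul, ← mul_sub]
    rw [projectiveTensor_codazzi hΓx hφx hρx htorx hsymm hcurv]

/-- In coordinates the covariant derivative is dσ + Γσ, which is smooth when `Γ` and `σ` are. -/
theorem isSmoothConnectionOn_of_isChristoffelSymbolAt (hU : IsOpen U)
    (hUp : U ⊆ coordDomain (n := n) F V p) (hcov : IsCovariantDerivativeOn F D U)
    (hD : ∀ x ∈ U, IsChristoffelSymbolAt p D Γ x)
    (hΓ : ∀ x ∈ U, ContDiffAt ℝ ∞ Γ (extChartAt (𝓡 n) p x)) : IsSmoothConnectionOn F D U where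
  isCovariantDerivativeOn := hcov
  smooth := ⟨fun {σ} hσ x hxU ↦ by
    have hx := hUp hxU
    have hσx : SmoothSectionAt (n := n) F σ x := hσ.contMDiffAt (hU.mem_nhds hxU)
    have hσ' := (smoothSectionAt_iff_coordSection hx).1 hσx
    have hdσ := hσ'.fderiv_right (m := ∞) (by simp)
    refine ContMDiffAt.contMDiffWithinAt ((contDiffAt_coordHom_iff (φ := D σ) hx).1 ?_)
    refine contDiffAt_clm_apply.2 fun v ↦ ?_
    have he : (fun z ↦ coordHom F p (D σ) z v) =ᶠ[𝓝 (extChartAt (𝓡 n) p x)]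
        fun z ↦ fderiv ℝ (coordSection F p σ) z v + Γ z v (coordSection F p σ z) := by
      refine eventually_extChartAt_nhds (P := fun z y ↦
        fiberCoord F V p y (D σ y (tangentFrame p y v)) =
        fderiv ℝ (coordSection F p σ) z v + Γ z v (coordSection F p σ z)) hx.1 ?_
      filter_upwards [hU.mem_nhds hxU, hσx.eventually_mdifferentiableAt] with y hy hσy
      have hv := fiberCoord_fiberFrame (F := EuclideanSpace ℝ (Fin n))
        (V := (TangentSpace (𝓡 n) : M → Type _)) (p := p) (x := y) (hUp hy).1 v
      rw [hD y hy σ hσy, coordSection_apply (hUp hy).1, tangentCoord, tangentFrame, hv]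
    have hΓx := hΓ x hxU
    exact ContDiffAt.congr_of_eventuallyEq (by fun_prop) he⟩

/-- The connection `∇_X σ + ρ(φ(X)) σ + ρ(σ) φ(X)`. -/
def projectivelyChangedConnection (φ : Π x : M, TangentSpace (𝓡 n) x →L[ℝ] V x)
    (ρ : Π x : M, V x →L[ℝ] ℝ)
    (D : (Π x : M, V x) → Π x : M, TangentSpace (𝓡 n) x →L[ℝ] V x)
    (σ : Π x : M, V x) (x : M) : TangentSpace (𝓡 n) x →L[ℝ] V x :=
  D σ x + ((ρ x).comp (φ x)).smulRight (σ x) + ρ x (σ x) • φ x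

theorem IsCovariantDerivativeOn.projectivelyChangedConnection
    (hD : IsCovariantDerivativeOn F D U) :
    IsCovariantDerivativeOn F (projectivelyChangedConnection φ ρ D) U where
  add hσ hσ' hx := by
    ext v
    simp [_root_.projectivelyChangedConnection, hD.add hσ hσ' hx]
    module
  leibniz hσ hg hx := by
    ext v
    simp [_root_.projectivelyChangedConnection, hD.leibniz hσ hg hx]
    module

/-- The system for `ρ` can be solved locally. -/
theorem exists_projectiveTensor_eq {E : Type*} [NormedAddCommGroup E] [NormedSpace ℝ E]
    [FiniteDimensional ℝ E] {Γ : E → E →L[ℝ] F →L[ℝ] F} {φ : E → E →L[ℝ] F}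
    {B : E → E →L[ℝ] F →L[ℝ] ℝ} {z₀ : E}
    (hreg : ∀ᶠ z in 𝓝 z₀, ContDiffAt ℝ ∞ Γ z ∧ ContDiffAt ℝ ∞ φ z ∧ ContDiffAt ℝ ∞ B z)
    (hint : ∀ᶠ z in 𝓝 z₀, LocallyTorsionFreeAt Γ φ z ∧ (∀ h k, B z h (φ z k) = B z k (φ z h)) ∧
      (∀ h k f, localCurvature Γ z h k f = B z k f • φ z h - B z h f • φ z k) ∧
      ∀ h k f, fderiv ℝ B z h k f - fderiv ℝ B z k h f = B z k (Γ z h f) - B z h (Γ z k f)) :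
    ∃ ρ : E → F →L[ℝ] ℝ, ∀ᶠ z in 𝓝 z₀,
      ContDiffAt ℝ ∞ ρ z ∧ projectiveTensor Γ φ ρ z = B z := by
  obtain ⟨hΓ, hφ, hB⟩ := hreg.self_of_nhds
  have h2 : (2 : ℕ∞ω) ≤ ∞ := WithTop.coe_le_coe.2 (le_top : (2 : ℕ∞) ≤ ⊤)
  -- The initial covector 0 is an arbitrary choice: the system is integrable at every value of the
  -- unknown.
  have hG : ContDiffAt ℝ 2 (projectiveSystem Γ φ B) (z₀, (0 : F →L[ℝ] ℝ)) :=
    ContDiffAt.projectiveSystem (hΓ.of_le h2) (hφ.of_le h2) (hB.of_le h2)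
  obtain ⟨ρ, hρ⟩ := exists_eventually_hasFDerivAt_of_total_system hG (by
    have hfst : Tendsto (Prod.fst : E × (F →L[ℝ] ℝ) → E) (𝓝 (z₀, 0)) (𝓝 z₀) :=
      continuous_fst.tendsto _
    filter_upwards [hfst (hreg.and hint)] with q hq h k
    obtain ⟨⟨h1, h2, h3⟩, h4, h5, h6, h7⟩ := hq
    exact projectiveSystem_integrable (h1.of_le (by simp)) (h2.of_le (by simp))
      (h3.of_le (by simp)) h4 h5 h6 h7 h k)
  obtain ⟨s, hs, hso, hz₀⟩ := eventually_nhds_iff.1 (hreg.and hρ)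
  have hsm : ContDiffOn ℝ ∞ ρ s := contDiffOn_of_total_system (t := s ×ˢ univ) hso
    (fun q hq ↦ (ContDiffAt.projectiveSystem (hs _ hq.1).1.1 (hs _ hq.1).1.2.1
      (hs _ hq.1).1.2.2).contDiffWithinAt) (fun x hx ↦ (hs x hx).2) (fun x hx ↦ ⟨hx, mem_univ _⟩)
  refine ⟨ρ, ?_⟩
  filter_upwards [hso.mem_nhds hz₀] with z hz
  refine ⟨hsm.contDiffAt (hso.mem_nhds hz), ?_⟩
  ext h f
  rw [projectiveTensor_apply, (hs z hz).2.fderiv, projectiveSystem_apply]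
  ring

theorem projectiveTensor_congr {E : Type*} [NormedAddCommGroup E] [NormedSpace ℝ E]
    {Γ : E → E →L[ℝ] F →L[ℝ] F} {φ : E → E →L[ℝ] F} {ρ ρ' : E → F →L[ℝ] ℝ} {z : E}
    (h : ρ =ᶠ[𝓝 z] ρ') : projectiveTensor Γ φ ρ z = projectiveTensor Γ φ ρ' z := by
  ext v f
  simp [h.fderiv_eq, h.self_of_nhds]

/-- The added terms ρ(φ(h)) φ(k) + ρ(φ(k)) φ(h) are symmetric in `h` and `k`, so they drop out of
the torsion. -/
theorem LocallyTorsionFreeAt.projectiveChange {E : Type*} [NormedAddCommGroup E] [NormedSpace ℝ E]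
    {Γ : E → E →L[ℝ] F →L[ℝ] F} {φ : E → E →L[ℝ] F} {z : E} (h : LocallyTorsionFreeAt Γ φ z)
    (ρ : E → F →L[ℝ] ℝ) : LocallyTorsionFreeAt (projectiveChange Γ φ ρ) φ z := by
  intro v w
  have := h v w
  rw [projectiveChange_apply, projectiveChange_apply, add_assoc (Γ z v _), ← add_assoc, this]
  abel

/-- A tensor satisfying the two conditions yields projective flatness. -/
theorem projectivelyFlat_of_conditions [T2Space M]
    (hφ : SmoothSection n (EuclideanSpace ℝ (Fin n) →L[ℝ] F) φ)
    (hD : IsSmoothConnectionOn F D univ) (htor : RelativelyTorsionFreeOn φ D univ)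
    (htr : TraceFreeCurvature F D)
    (hA : SmoothSection n (EuclideanSpace ℝ (Fin n) →L[ℝ] F →L[ℝ] ℝ) A)
    (hcurv : CurvatureCondition F φ D A) (hcod : CodazziCondition F D A) :
    ProjectivelyFlat F φ D := by
  intro p
  obtain ⟨Γ, hΓ⟩ := hD.exists_isChristoffelSymbolAt isOpen_univ p
  simp only [univ_inter] at hΓ
  let φ' := coordHom F p φ
  let B := fun z ↦ (1 / ((n : ℝ) - 1)) • coordForm F p A z
  have hev : ∀ x ∈ coordDomain (n := n) F V p, ∀ᶠ y in 𝓝 x, IsChristoffelSymbolAt p D Γ y :=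
    fun x hx ↦ (eventually_mem_coordDomain hx).mono fun y hy ↦ (hΓ y hy).1
  have hφx : ∀ x ∈ coordDomain (n := n) F V p, ContDiffAt ℝ ∞ φ' (extChartAt (𝓡 n) p x) :=
    fun x hx ↦ (contDiffAt_coordHom_iff hx).2 (hφ.smoothSectionAt x)
  have hAx : ∀ x ∈ coordDomain (n := n) F V p,
      ContDiffAt ℝ ∞ (coordForm F p A) (extChartAt (𝓡 n) p x) :=
    fun x hx ↦ (contDiffAt_coordForm_iff hx).2 (SmoothSection.smoothSectionAt hA x)
  have hBx : ∀ x ∈ coordDomain (n := n) F V p, ContDiffAt ℝ ∞ B (extChartAt (𝓡 n) p x) :=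
    fun x hx ↦ (hAx x hx).const_smul _
  have htorx : ∀ x ∈ coordDomain (n := n) F V p,
      LocallyTorsionFreeAt Γ φ' (extChartAt (𝓡 n) p x) := fun x hx ↦
    htor.locallyTorsionFreeAt (mem_univ x) (hΓ x hx).1 hx (hφ.smoothSectionAt x)
  have hcurvx : ∀ x ∈ coordDomain (n := n) F V p, ∀ v w f,
      localCurvature Γ (extChartAt (𝓡 n) p x) v w f =
        B (extChartAt (𝓡 n) p x) w f • φ' (extChartAt (𝓡 n) p x) v -
        B (extChartAt (𝓡 n) p x) v f • φ' (extChartAt (𝓡 n) p x) w := fun x hx v w f ↦ by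
    rw [(curvatureConditionAt_iff (A := A) (hev x hx) (hΓ x hx).2 hx).1
      fun X Y hX hY η hη ↦ hcurv X Y hX hY η hη x]
    simp only [B, smul_apply, smul_eq_mul, mul_smul, smul_sub, φ']
  have hcodx : ∀ x ∈ coordDomain (n := n) F V p, ∀ v w f,
      fderiv ℝ B (extChartAt (𝓡 n) p x) v w f - fderiv ℝ B (extChartAt (𝓡 n) p x) w v f =
      B (extChartAt (𝓡 n) p x) w (Γ (extChartAt (𝓡 n) p x) v f) -
      B (extChartAt (𝓡 n) p x) v (Γ (extChartAt (𝓡 n) p x) w f) := fun x hx v w f ↦ by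
    have := (codazziConditionAt_iff (hΓ x hx).1 hx (SmoothSection.smoothSectionAt hA x)).1
      (fun X Y hX hY η hη ↦ hcod X Y hX hY η hη x) v w f
    simp only [B]
    rw [fderiv_fun_const_smul ((hAx x hx).differentiableAt (by simp))]
    simp only [smul_apply, smul_eq_mul, ← mul_sub, this]
  -- By the curvature condition the trace of R(v, w) is B(w, φv) - B(v, φw), so trace-freeness is
  -- this symmetry.
  have hsymm : ∀ x ∈ coordDomain (n := n) F V p, ∀ v w,
      B (extChartAt (𝓡 n) p x) v (φ' (extChartAt (𝓡 n) p x) w) =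
      B (extChartAt (𝓡 n) p x) w (φ' (extChartAt (𝓡 n) p x) v) := fun x hx v w ↦ by
    have h1 := htr.trace_localCurvature (hev x hx) (hΓ x hx).2 hx v w
    rw [trace_eq_of_apply_eq (β := 0) (b₁ := B (extChartAt (𝓡 n) p x) w)
      (b₂ := B (extChartAt (𝓡 n) p x) v) (v₁ := φ' (extChartAt (𝓡 n) p x) v)
      (v₂ := φ' (extChartAt (𝓡 n) p x) w) (fun f ↦ by
        rw [zero_smul, zero_add]; exact hcurvx x hx v w f)] at h1
    linarith
  have hp := mem_coordDomain_self (n := n) F V p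
  obtain ⟨u, hu⟩ := exists_projectiveTensor_eq (Γ := Γ) (φ := φ') (B := B)
    (z₀ := extChartAt (𝓡 n) p p)
    (eventually_extChartAt_nhds (P := fun z _ ↦ _) hp.1 <|
      (eventually_mem_coordDomain hp).mono fun x hx ↦ ⟨(hΓ x hx).2, hφx x hx, hBx x hx⟩)
    (eventually_extChartAt_nhds (P := fun z _ ↦ _) hp.1 <|
      (eventually_mem_coordDomain hp).mono fun x hx ↦
        ⟨htorx x hx, hsymm x hx, hcurvx x hx, hcodx x hx⟩)
  obtain ⟨U, hU, hUo, hpU⟩ := eventually_nhds_iff.1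
    ((eventually_mem_coordDomain hp).and (continuousAt_extChartAt_apply hp.1 hu))
  have hUp : U ⊆ coordDomain (n := n) F V p := fun x hx ↦ (hU x hx).1
  let ρ : Π x : M, V x →L[ℝ] ℝ := covectorOfCoord p u
  let D' := projectivelyChangedConnection φ ρ D
  let Γ' := projectiveChange Γ φ' (coordCovector (n := n) F p ρ)
  have hρe : ∀ x ∈ U, coordCovector (n := n) F p ρ =ᶠ[𝓝 (extChartAt (𝓡 n) p x)] u :=
    fun x hx ↦ coordCovector_covectorOfCoord_eventuallyEq (hUp hx) u
  have hρx : ∀ x ∈ U, ContDiffAt ℝ ∞ (coordCovector (n := n) F p ρ) (extChartAt (𝓡 n) p x) :=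
    fun x hx ↦ (hU x hx).2.1.congr_of_eventuallyEq (hρe x hx)
  have hD' : ∀ x ∈ U, IsChristoffelSymbolAt p D' Γ' x := fun x hx ↦
    (hΓ x (hUp hx)).1.of_projective_change (hUp hx) fun σ _ v ↦ rfl
  have hΓ' : ∀ x ∈ U, ContDiffAt ℝ ∞ Γ' (extChartAt (𝓡 n) p x) := fun x hx ↦
    (hΓ x (hUp hx)).2.projectiveChange (hφx x (hUp hx)) (hρx x hx)
  refine ⟨U, hUo, hpU, D', ?_, fun X Y hX hY σ hσ x hx ↦ ?_, ?_, ?_, ρ, fun x hx ↦ ?_,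
    fun X _ σ _ x _ ↦ rfl⟩
  · exact isSmoothConnectionOn_of_isChristoffelSymbolAt hUo hUp
      (hD.isCovariantDerivativeOn.mono (subset_univ U)).projectivelyChangedConnection hD' hΓ'
  · apply fiberCoord_injective (hUp hx).2
    have hev' : ∀ᶠ y in 𝓝 x, IsChristoffelSymbolAt p D' Γ' y := by
      filter_upwards [hUo.mem_nhds hx] with y hy using hD' y hy
    -- With P = B, the symmetry removes the identity term of the curvature formula and the other two
    -- terms cancel the original curvature.
    have hB := (projectiveTensor_congr (Γ := Γ) (φ := φ') (hρe x hx)).trans (hU x hx).2.2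
    rw [map_zero, fiberCoord_curvature hev' (hΓ' x hx) (hUp hx)
      (SmoothSectionOn.smoothSectionAt hX (hUo.mem_nhds hx))
      (SmoothSectionOn.smoothSectionAt hY (hUo.mem_nhds hx))
      (hσ.smoothSectionAt (hUo.mem_nhds hx)), localCurvature_projectiveChange
      ((hΓ x (hUp hx)).2.of_le (by simp)) ((hφx x (hUp hx)).of_le (by simp))
      ((hρx x hx).of_le (by simp)) (htorx x (hUp hx)), hB, hsymm x (hUp hx), hcurvx x (hUp hx)]
    module
  · exact fun X Y hX hY x hx ↦ (relativelyTorsionFreeOn_of_locallyTorsionFreeAt hUo hUp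
      (fun x hx ↦ (hΓ x (hUp hx)).1) (fun x _ ↦ hφ.smoothSectionAt x)
      fun x hx ↦ htorx x (hUp hx)) X Y hX hY x hx
  · exact relativelyTorsionFreeOn_of_locallyTorsionFreeAt hUo hUp hD'
      (fun x _ ↦ hφ.smoothSectionAt x) fun x hx ↦ (htorx x (hUp hx)).projectiveChange _
  · exact ContMDiffAt.contMDiffWithinAt ((contDiffAt_coordCovector_iff (hUp hx)).1 (hρx x hx))

end Equivalence

end

theorem mainTheorem3 {n : ℕ} {M : Type*} [TopologicalSpace M]
    [ChartedSpace (EuclideanSpace ℝ (Fin n)) M] [IsManifold (𝓡 n) ∞ M]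
    [T2Space M] [SecondCountableTopology M]
    {F : Type*} [NormedAddCommGroup F] [NormedSpace ℝ F] [FiniteDimensional ℝ F]
    {V : M → Type*} [TopologicalSpace (TotalSpace F V)]
    [∀ x, AddCommGroup (V x)] [∀ x, Module ℝ (V x)] [∀ x, TopologicalSpace (V x)]
    [∀ x, IsTopologicalAddGroup (V x)] [∀ x, ContinuousSMul ℝ (V x)]
    [FiberBundle F V] [VectorBundle ℝ F V] [ContMDiffVectorBundle ∞ F V (𝓡 n)]
    (𝓔 : CoherentTangentBundle n M F V)
    (hrank : RankGEAlmostEverywhere 𝓔.phi 2)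
    (htrace : TraceFreeCurvature F 𝓔.conn) :
    ProjectivelyFlat F 𝓔.phi 𝓔.conn ↔
      ∃ A : Π x : M, TangentSpace (𝓡 n) x →L[ℝ] V x →L[ℝ] ℝ,
        SmoothSection n (EuclideanSpace ℝ (Fin n) →L[ℝ] F →L[ℝ] ℝ) A ∧
        CurvatureCondition F 𝓔.phi 𝓔.conn A ∧ CodazziCondition F 𝓔.conn A := by
  refine ⟨fun h ↦ exists_global_tensor hrank fun p ↦ ?_, fun ⟨A, hA, hcurv, hcod⟩ ↦ ?_⟩
  -- Points of rank at least two exist near `p`, so `n ≥ 2` and `n - 1` is invertible.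
  · exact h.exists_local_tensor (hrank.le_dim p) 𝓔.smooth_phi 𝓔.smooth_conn
      𝓔.relativelyTorsionFree htrace p
  · exact projectivelyFlat_of_conditions 𝓔.smooth_phi 𝓔.smooth_conn 𝓔.relativelyTorsionFree htrace
      hA hcurv hcod
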